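/- Identify $\mathbb R^2$ with the plane with polar coordinates $(r,\theta)$ centred at $O=0$, and let $\Xi=\{y>0\}$. Let $\sigma_+>0>\sigma_-$ be constants with $\sigma_- /\sigma_+\in(-1,-1/3)$, put $a=\frac12\frac{\sigma_+-\sigma_-}{\sigma_++\sigma_-}>1$ and $$\mu=-\tfrac2\pi\ln\big(a-\sqrt{a^2-1}\big)>0 .$$ Let $\phi(\theta)=c_\phi\frac{\sinh(\mu\theta)}{\sinh(\mu\pi/4)}$ on $[0,\pi/4]$ and $\phi(\theta)=c_\phi\frac{\sinh(\mu(\pi-\theta))}{\sinh(3\mu\pi/4)}$ on $[\pi/4,\pi]$, where $c_\phi\in\mathbb R$ is chosen so that $\mu\int_0^\pi\sigma^0(\theta)\phi(\theta)^2\,d\theta=1$, with $\sigma^0(\theta)=\sigma_-$ for $\theta<\pi/4$ and $\sigma^0(\theta)=\sigma_+$ for $\theta>\pi/4$. Let $\psi\in C^\infty(\mathbb R;[0,1])$ with $\psi(r)=1$ for $r\le1$ and $\psi(r)=0$ for $r\ge2$, let $\chi=1-\psi$, and let $\beta\in(0,2)$. (1) *Outer problem.* Let $\Omega\subset\mathbb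 R^2$ be a bounded connected open set with Lipschitz boundary containing $\{|x|<2\}\cap\Xi$, cut by a straight segment $\Sigma^0=[O,O']$, which meets $\partial\Omega$ exactly at its two end points $O$ and $O'\ne O$, into two disjoint open sets $\Omega_\pm$ with $\Omega_+\cup\Omega_-=\Omega\setminus\Sigma^0$ and $\overline{\Omega_+}\cap\overline{\Omega_-}=\Sigma^0$. Assume that $\Omega_-$ and $\Omega_+$ coincide in $\{|x|<2\}$ with the sectors $\{0<\theta<\pi/4\}$ and $\{\pi/4<\theta<\pi\}$, and that near $O'$ the boundary $\partial\Omega$ is straight and perpendicular to $\Sigma^0$. Let $\sigma^0=\sigma_\pm$ in $\Omega_\pm$. For $\gamma\in\mathbb R$ let $\mathring V^1_\gamma(\Omega)$ be the completion of $C_0^\infty(\Omega)$ for the norm $\big(\int_\Omega r^{2(\gamma-1)}|v|^2+r^{2\gamma}|\nabla v|^2\,dx\big)^{1/2}$. Suppose that $\zeta\in\mathring V^1_\beta(\Omega)$ satisfies $\int_\Omega\sigma^0\nabla\zeta\cdot\overline{\nabla v}\,dx=0$ for all $v\in\mathring V^1_{-\beta}(\Omega)$ and that, for some $c_\zeta\in\mathbb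 C$, $$\zeta=\psi(r)r^{-i\mu}\phi(\theta)+c_\zeta\,\psi(r)r^{i\mu}\phi(\theta)+\tilde\zeta,\qquad \tilde\zeta\in\mathring V^1_{-\beta}(\Omega).$$ Then $|c_\zeta|=1$. (2) *Inner problem.* Let $\Gamma=\{\varphi_\Gamma(t):t\ge0\}$, with $\varphi_\Gamma:[0,\infty)\to\mathbb R^2$ of class $C^\infty$, $\varphi_\Gamma'(0)$ orthogonal to the $x$-axis and $\varphi_\Gamma(t)=(t,t)$ for $t\ge1$. Let $\Xi_\pm$ be disjoint open sets with $\Xi_+\cup\Xi_-=\Xi\setminus\Gamma$ and $\overline{\Xi_+}\cap\overline{\Xi_-}=\Gamma$ such that, outside some disc centred at $O$, $\Xi_-$ contains the sector $\{0<\theta<\pi/4\}$ and $\Xi_+$ contains the sector $\{\pi/4<\theta<\pi\}$. Let $\sigma^\infty=\sigma_\pm$ in $\Xi_\pm$. For $\gamma\in\mathbb R$ let $\mathring{\mathcal V}^1_\gamma(\Xi)$ be the completion of $C_0^\infty(\Xi)$ for the norm $\big(\int_\Xi(1+r)^{2(\gamma-1)}|v|^2+(1+r)^{2\gamma}|\nabla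 v|^2\,dx\big)^{1/2}$. Suppose that $Z\in\mathring{\mathcal V}^1_{-\beta}(\Xi)$ satisfies $\int_\Xi\sigma^\infty\nabla Z\cdot\overline{\nabla v}\,dx=0$ for all $v\in\mathring{\mathcal V}^1_{\beta}(\Xi)$ and that, for some $C_Z\in\mathbb C$, $$Z=\chi(r)r^{i\mu}\phi(\theta)+C_Z\,\chi(r)r^{-i\mu}\phi(\theta)+\tilde Z,\qquad \tilde Z\in\mathring{\mathcal V}^1_{\beta}(\Xi).$$ Then $|C_Z|=1$. -/

import Mathlib

open MeasureTheory Filter Topology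
open scoped ContDiff ENNReal

noncomputable section

namespace SignChanging

/-! The plane `ℝ²` is identified with `ℂ`: `x = re z`, `y = im z`, `r = ‖z‖`, `θ = arg z`,
and partial derivatives are taken over `ℝ` in the directions `1` and `I`. -/

/-! ### Test functions, gradients, weighted spaces -/

/-- `f ∈ C₀^∞(Ω)`, with complex values. -/
def IsTest (Ω : Set ℂ) (f : ℂ → ℂ) : Prop :=
  ContDiff ℝ ∞ f ∧ HasCompactSupport f ∧ tsupport f ⊆ Ω

/-- The classical gradient `(∂ₓ f, ∂_y f)`. -/
def grad (f : ℂ → ℂ) (z : ℂ) : ℂ × ℂ :=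
  (fderiv ℝ f z 1, fderiv ℝ f z Complex.I)

/-- `G = (G₁, G₂)` is the distributional gradient of `v` in `Ω`. -/
def IsWeakGrad (Ω : Set ℂ) (v : ℂ → ℂ) (G : ℂ → ℂ × ℂ) : Prop :=
  LocallyIntegrableOn v Ω volume ∧
  LocallyIntegrableOn (fun z => (G z).1) Ω volume ∧
  LocallyIntegrableOn (fun z => (G z).2) Ω volume ∧
  ∀ f : ℂ → ℂ, IsTest Ω f →
    (∫ z in Ω, v z * (grad f z).1 = -∫ z in Ω, (G z).1 * f z) ∧
    (∫ z in Ω, v z * (grad f z).2 = -∫ z in Ω, (G z).2 * f z)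

/-- The squared weighted norm `∫_Ω w^{2(β-1)} |v|² + w^{2β} |G|²`, where `G` is the gradient
of `v`. The weight `w` is `r` in the outer domain and `1 + ρ` in the inner domain. -/
def weightedNormSq (Ω : Set ℂ) (w : ℂ → ℝ) (β : ℝ) (v : ℂ → ℂ) (G : ℂ → ℂ × ℂ) : ℝ≥0∞ :=
  ∫⁻ z in Ω, ENNReal.ofReal
    (w z ^ (2 * (β - 1)) * ‖v z‖ ^ 2 + w z ^ (2 * β) * (‖(G z).1‖ ^ 2 + ‖(G z).2‖ ^ 2))

/-- The weighted space with homogeneous Dirichlet condition: the completion of `C₀^∞(Ω)` for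
the weighted norm, realised as a set of functions on `Ω` (the values of `v` outside `Ω` play
no role). -/
def MemV (Ω : Set ℂ) (w : ℂ → ℝ) (β : ℝ) (v : ℂ → ℂ) : Prop :=
  ∃ G : ℂ → ℂ × ℂ, IsWeakGrad Ω v G ∧
    ∃ f : ℕ → ℂ → ℂ, (∀ n, IsTest Ω (f n)) ∧
      Tendsto (fun n => weightedNormSq Ω w β (fun z => v z - f n z) (fun z => G z - grad (f n) z))
        atTop (𝓝 0)

/-- `(σ ∇u, ∇v)_Ω`, in terms of the gradients `G` of `u` and `H` of `v`. -/
def form (Ω : Set ℂ) (σ : ℂ → ℝ) (G H : ℂ → ℂ × ℂ) : ℂ :=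
  ∫ z in Ω, (σ z : ℂ) *
    ((G z).1 * starRingEnd ℂ (H z).1 + (G z).2 * starRingEnd ℂ (H z).2)

/-- `u` lies in the kernel of the operator from the space with exponent `β` to the antidual of
the space with exponent `-β` given by `⟨A u, v⟩ = (σ ∇u, ∇v)_Ω`. -/
def MemKer (Ω : Set ℂ) (σ : ℂ → ℝ) (w : ℂ → ℝ) (β : ℝ) (u : ℂ → ℂ) : Prop :=
  MemV Ω w β u ∧
  ∀ G : ℂ → ℂ × ℂ, IsWeakGrad Ω u G →
    ∀ (v : ℂ → ℂ) (H : ℂ → ℂ × ℂ), MemV Ω w (-β) v → IsWeakGrad Ω v H →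
      form Ω σ G H = 0

/-- Weight of the outer domain. -/
def outerWeight (z : ℂ) : ℝ := ‖z‖

/-- Weight of the inner domain. -/
def innerWeight (z : ℂ) : ℝ := 1 + ‖z‖

/-! ### Geometry -/

/-- The open sector `{a < θ < b, 0 < r}` (for `-π ≤ a`, `b ≤ π`). -/
def sector (a b : ℝ) : Set ℂ := {z | z ≠ 0 ∧ a < z.arg ∧ z.arg < b}

/-- The upper half plane `Ξ`. -/
def Xi : Set ℂ := {z | 0 < z.im}

/-- `Ω` has a Lipschitz boundary: near each boundary point, in suitable Cartesian coordinates
`(s, t)` centred at the point, `Ω` is the region above the graph of a Lipschitz function. -/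
def HasLipschitzBoundary (Ω : Set ℂ) : Prop :=
  ∀ x ∈ frontier Ω, ∃ (e : ℂ) (K : NNReal) (g : ℝ → ℝ) (a h : ℝ),
    ‖e‖ = 1 ∧ LipschitzWith K g ∧ 0 < a ∧ 0 < h ∧
    ∀ s t : ℝ, |s| < a → |t| < h → (x + e * (s + t * Complex.I) ∈ Ω ↔ g s < t)

/-- Outer limit geometry: a bounded Lipschitz domain `Ω`, cut by the straight segment
`Σ⁰ = [O, O']` (with `O = 0`) into `Ω₊` and `Ω₋`. -/
structure OuterGeometry (Ω Ωp Ωm : Set ℂ) (O' : ℂ) : Prop where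
  isOpen : IsOpen Ω
  isConnected : IsConnected Ω
  isBounded : Bornology.IsBounded Ω
  lipschitz : HasLipschitzBoundary Ω
  isOpen_p : IsOpen Ωp
  isOpen_m : IsOpen Ωm
  disjoint : Disjoint Ωp Ωm
  union : Ωp ∪ Ωm = Ω \ segment ℝ 0 O'
  interface : closure Ωp ∩ closure Ωm = segment ℝ 0 O'
  ne : O' ≠ 0
  endpoints : segment ℝ 0 O' ∩ frontier Ω = {0, O'}
  /-- Near `O'` the boundary is straight and perpendicular to the segment. -/
  perp : ∃ ε > 0, Ω ∩ Metric.ball O' ε =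
    {z | ((z - O') * starRingEnd ℂ O').re < 0} ∩ Metric.ball O' ε
  halfDisc : Xi ∩ Metric.ball 0 2 ⊆ Ω
  corner_m : Ωm ∩ Metric.ball 0 2 = sector 0 (Real.pi / 4) ∩ Metric.ball 0 2
  corner_p : Ωp ∩ Metric.ball 0 2 = sector (Real.pi / 4) Real.pi ∩ Metric.ball 0 2

/-- Inner limit geometry: the half plane `Ξ`, cut by the smooth curve `Γ = γ([0, ∞))` into
`Ξ₊` and `Ξ₋`. -/
structure InnerGeometry (Ξp Ξm : Set ℂ) (γ : ℝ → ℂ) : Prop where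
  isOpen_p : IsOpen Ξp
  isOpen_m : IsOpen Ξm
  disjoint : Disjoint Ξp Ξm
  union : Ξp ∪ Ξm = Xi \ γ '' Set.Ici 0
  interface : closure Ξp ∩ closure Ξm = γ '' Set.Ici 0
  smooth : ContDiffOn ℝ ∞ γ (Set.Ici 0)
  /-- The tangent at the starting point is orthogonal to the `x`-axis. -/
  perp : (derivWithin γ (Set.Ici 0) 0).re = 0
  diagonal : ∀ t : ℝ, 1 ≤ t → γ t = t + t * Complex.I
  /-- Far from the origin, `Ξ₋` lies below the diagonal and `Ξ₊` above. -/
  far : ∃ R : ℝ, (∀ z ∈ sector 0 (Real.pi / 4), R < ‖z‖ → z ∈ Ξm) ∧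
    (∀ z ∈ sector (Real.pi / 4) Real.pi, R < ‖z‖ → z ∈ Ξp)

open Classical in
/-- The piecewise constant coefficient: `σ₊` in the set `P`, `σ₋` in the set `M`. -/
def coeff (σp σm : ℝ) (P M : Set ℂ) (z : ℂ) : ℝ :=
  if z ∈ P then σp else if z ∈ M then σm else 0

/-! ### Singular exponent and singular functions -/

/-- The number `a = (1/2) (σ₊ - σ₋) / (σ₊ + σ₋)`; it is `> 1` when `-1 < σ₋/σ₊ < -1/3`. -/
def contrast (σp σm : ℝ) : ℝ := (1 / 2) * ((σp - σm) / (σp + σm))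

/-- The exponent `μ = -(2/π) ln (a + i √(1 - a²))`, where `i √(1 - a²) = -√(a² - 1)`. Equivalently,
`μ > 0` and `cosh (π μ / 2) = a`; for this `μ` the function `φ` below satisfies the transmission
condition `σ₋ φ' = σ₊ φ'` at `θ = π/4`. -/
def mu (σp σm : ℝ) : ℝ :=
  -(2 / Real.pi) * Real.log (contrast σp σm - √(contrast σp σm ^ 2 - 1))

/-- The angular function `φ`, with multiplicative constant `c`. -/
def phi (μ c θ : ℝ) : ℝ :=
  if θ ≤ Real.pi / 4 then c * (Real.sinh (μ * θ) / Real.sinh (μ * (Real.pi / 4)))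
  else c * (Real.sinh (μ * (Real.pi - θ)) / Real.sinh (μ * (3 * Real.pi / 4)))

/-- The coefficient near the corner as a function of the angle. -/
def sigmaAngle (σp σm θ : ℝ) : ℝ := if θ < Real.pi / 4 then σm else σp

/-- The normalization `μ ∫₀^π σ⁰ φ² = 1`. -/
def IsNormalized (σp σm c : ℝ) : Prop :=
  mu σp σm * ∫ θ in (0 : ℝ)..Real.pi, sigmaAngle σp σm θ * phi (mu σp σm) c θ ^ 2 = 1

/-- The function `r^{i s} φ(θ)`. -/
def singular (s μ c : ℝ) (z : ℂ) : ℂ :=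
  (‖z‖ : ℂ) ^ (Complex.I * s) * phi μ c z.arg

/-- The cut-off function `ψ`: smooth, with values in `[0, 1]`, equal to `1` for `r ≤ 1` and to
`0` for `r ≥ 2`. -/
def IsCutoff (ψ : ℝ → ℝ) : Prop :=
  ContDiff ℝ ∞ ψ ∧ (∀ r, ψ r ∈ Set.Icc (0 : ℝ) 1) ∧ (∀ r ≤ 1, ψ r = 1) ∧ ∀ r, 2 ≤ r → ψ r = 0

/-- `ζ = ψ r^{-iμ} φ + c_ζ ψ r^{iμ} φ + ζ̃` in `Ω`, with `ζ̃` in the space of exponent `-β`. -/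
def OuterExpansion (Ω : Set ℂ) (ψ : ℝ → ℝ) (β μ c : ℝ) (ζ : ℂ → ℂ) (cζ : ℂ) : Prop :=
  ∃ ζt : ℂ → ℂ, MemV Ω outerWeight (-β) ζt ∧
    ∀ᵐ z ∂(volume.restrict Ω), ζ z =
      (ψ ‖z‖ : ℂ) * singular (-μ) μ c z + cζ * ((ψ ‖z‖ : ℂ) * singular μ μ c z) + ζt z

/-- `Z = χ ρ^{iμ} φ + C_Z χ ρ^{-iμ} φ + Z̃` in `Ξ`, with `χ = 1 - ψ` and `Z̃` in the space of
exponent `β`. -/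
def InnerExpansion (ψ : ℝ → ℝ) (β μ c : ℝ) (Z : ℂ → ℂ) (CZ : ℂ) : Prop :=
  ∃ Zt : ℂ → ℂ, MemV Xi innerWeight β Zt ∧
    ∀ᵐ z ∂(volume.restrict Xi), Z z =
      ((1 - ψ ‖z‖ : ℝ) : ℂ) * singular μ μ c z
        + CZ * (((1 - ψ ‖z‖ : ℝ) : ℂ) * singular (-μ) μ c z) + Zt z

end SignChanging

end

noncomputable section

namespace SignChanging

/-! ### Weak derivatives -/

/-! This is conservation of flux. Let `u` solve the homogeneous equation and let `ρ` be a real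
radial cut-off for which `ρ u` is an admissible test function. In `∫ σ ∇u · conj ∇(ρ u)` the term `ρ
σ |∇u|²` is real, whatever the sign of `σ`. The imaginary part therefore leaves `∫ σ Im(conj u ∇u ·
∇ρ) = 0`, an averaged flux through the annulus `t ≤ r ≤ 2t` (`MemKer.integral_fluxDensity`).
Averaging over an annulus avoids traces on circles.

On that annulus `u = A r^{-iμ} φ + B r^{iμ} φ + v`. As `∇ρ` is radial, only the radial derivative of
`u` enters. For the two waves alone the flux density is a multiple of `μ σ⁰ φ² (|B|² - |A|²)`
(`flux_wave`), and by the normalization of `φ` its integral is `±(|B|² - |A|²)` for every `t`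
(`integral_cutoffSlope_mul_angularFlux`). The terms containing `v` are controlled by the energy of
`v` on the annulus (`flux_remainder_le`), which becomes small because of the weight: as `t → 0` in
the outer problem, as `t → ∞` in the inner one. Hence `|A| = |B|` (`norm_eq_of_flux_eq_zero`), and
one of the two coefficients is `1`.

The cut-off also moves `u` between the weighted spaces: `1 - ψ(r/t)` removes the corner in the outer
problem, `ψ(r/t)` removes infinity in the inner one. -/

/-- `g` is the weak derivative of `v` in `Ω` in the direction `e`. -/
def HasWeakDeriv (Ω : Set ℂ) (e : ℂ) (v g : ℂ → ℂ) : Prop :=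
  LocallyIntegrableOn v Ω volume ∧ LocallyIntegrableOn g Ω volume ∧
  ∀ f : ℂ → ℂ, IsTest Ω f → ∫ z in Ω, v z * fderiv ℝ f z e = -∫ z in Ω, g z * f z

theorem isWeakGrad_iff {Ω : Set ℂ} {v : ℂ → ℂ} {G : ℂ → ℂ × ℂ} :
    IsWeakGrad Ω v G ↔ HasWeakDeriv Ω 1 v (fun z => (G z).1) ∧
      HasWeakDeriv Ω Complex.I v (fun z => (G z).2) := by
  constructor
  · rintro ⟨h1, h2, h3, h4⟩
    exact ⟨⟨h1, h2, fun f hf => (h4 f hf).1⟩, ⟨h1, h3, fun f hf => (h4 f hf).2⟩⟩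
  · rintro ⟨⟨h1, h2, h3⟩, ⟨_, h5, h6⟩⟩
    exact ⟨h1, h2, h5, fun f hf => ⟨h3 f hf, h6 f hf⟩⟩

theorem integrable_mul_of_tsupport_subset {Ω : Set ℂ} {v g : ℂ → ℂ}
    (hv : LocallyIntegrableOn v Ω volume) (hg : Continuous g) (hc : HasCompactSupport g)
    (hs : tsupport g ⊆ Ω) : Integrable (fun z => v z * g z) := by
  have h := (hv.integrableOn_compact_subset hs hc).mul_continuousOn hg.continuousOn hc
  refine (integrableOn_iff_integrable_of_support_subset ?_).1 h
  intro z hz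
  refine subset_tsupport g ?_
  rw [Function.mem_support] at hz ⊢
  exact right_ne_zero_of_mul hz

theorem IsTest.mono {U Ω : Set ℂ} {f : ℂ → ℂ} (hf : IsTest U f) (h : U ⊆ Ω) : IsTest Ω f :=
  ⟨hf.1, hf.2.1, hf.2.2.trans h⟩

theorem IsTest.eq_zero_of_notMem {Ω : Set ℂ} {f : ℂ → ℂ} (hf : IsTest Ω f) {z : ℂ}
    (hz : z ∉ Ω) : f z = 0 :=
  image_eq_zero_of_notMem_tsupport fun h => hz (hf.2.2 h)

theorem IsTest.hasCompactSupport_fderiv {Ω : Set ℂ} {f : ℂ → ℂ} (hf : IsTest Ω f) (e : ℂ) :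
    HasCompactSupport (fun z => fderiv ℝ f z e) :=
  hf.2.1.fderiv_apply ℝ e

theorem IsTest.tsupport_fderiv_subset {Ω : Set ℂ} {f : ℂ → ℂ} (hf : IsTest Ω f) (e : ℂ) :
    tsupport (fun z => fderiv ℝ f z e) ⊆ Ω :=
  (tsupport_fderiv_apply_subset ℝ e).trans hf.2.2

theorem IsTest.continuous_fderiv {Ω : Set ℂ} {f : ℂ → ℂ} (hf : IsTest Ω f) (e : ℂ) :
    Continuous (fun z => fderiv ℝ f z e) :=
  (hf.1.continuous_fderiv (by simp)).clm_apply continuous_const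

theorem IsTest.fderiv_eq_zero_of_notMem {Ω : Set ℂ} {f : ℂ → ℂ} (hf : IsTest Ω f) (e : ℂ) {z : ℂ}
    (hz : z ∉ Ω) : fderiv ℝ f z e = 0 :=
  image_eq_zero_of_notMem_tsupport (f := fun z => fderiv ℝ f z e)
    fun h => hz (hf.tsupport_fderiv_subset e h)

theorem HasWeakDeriv.integral_eq {Ω : Set ℂ} {e : ℂ} {v g : ℂ → ℂ} (h : HasWeakDeriv Ω e v g)
    {f : ℂ → ℂ} (hf : IsTest Ω f) : ∫ z, v z * fderiv ℝ f z e = -∫ z, g z * f z := by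
  have h1 := h.2.2 f hf
  rwa [setIntegral_eq_integral_of_forall_compl_eq_zero,
    setIntegral_eq_integral_of_forall_compl_eq_zero] at h1
  · intro z hz; simp [hf.eq_zero_of_notMem hz]
  · intro z hz; simp [hf.fderiv_eq_zero_of_notMem e hz]

theorem fderiv_ofReal_mul {ρ : ℂ → ℝ} {f : ℂ → ℂ} {z : ℂ} (hρ : DifferentiableAt ℝ ρ z)
    (hf : DifferentiableAt ℝ f z) (e : ℂ) :
    fderiv ℝ (fun z => (ρ z : ℂ) * f z) z e = ρ z * fderiv ℝ f z e + (fderiv ℝ ρ z e : ℝ) * f z := by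
  have h1 : HasFDerivAt (fun z => (ρ z : ℂ)) (Complex.ofRealCLM.comp (fderiv ℝ ρ z)) z :=
    Complex.ofRealCLM.hasFDerivAt.comp z hρ.hasFDerivAt
  have h2 : HasFDerivAt (fun z => (ρ z : ℂ) * f z) _ z := h1.mul hf.hasFDerivAt
  rw [h2.fderiv]
  simp [mul_comm]

theorem IsTest.ofReal_mul {Ω : Set ℂ} {f : ℂ → ℂ} (hf : IsTest Ω f) {ρ : ℂ → ℝ}
    (hρ : ContDiff ℝ ∞ ρ) : IsTest Ω (fun z => (ρ z : ℂ) * f z) :=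
  ⟨(Complex.ofRealCLM.contDiff.comp hρ).mul hf.1, hf.2.1.mul_left,
    (tsupport_mul_subset_right (f := fun z => (ρ z : ℂ))).trans hf.2.2⟩

theorem IsTest.grad_ofReal_mul {Ω : Set ℂ} {f : ℂ → ℂ} (hf : IsTest Ω f) {ρ : ℂ → ℝ}
    (hρ : ContDiff ℝ ∞ ρ) (z : ℂ) :
    grad (fun z => (ρ z : ℂ) * f z) z = (ρ z * (grad f z).1 + (fderiv ℝ ρ z 1 : ℝ) * f z,
      ρ z * (grad f z).2 + (fderiv ℝ ρ z Complex.I : ℝ) * f z) := by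
  have h1 : DifferentiableAt ℝ ρ z := hρ.differentiable (by simp) z
  have h2 : DifferentiableAt ℝ f z := hf.1.differentiable (by simp) z
  simp only [grad, fderiv_ofReal_mul h1 h2]

/-- The product rule for a weak derivative and a smooth factor. -/
theorem HasWeakDeriv.ofReal_mul {Ω : Set ℂ} (hΩ : IsOpen Ω) {e : ℂ} {v g : ℂ → ℂ}
    (h : HasWeakDeriv Ω e v g) {ρ : ℂ → ℝ} (hρ : ContDiff ℝ ∞ ρ) :
    HasWeakDeriv Ω e (fun z => ρ z * v z) (fun z => ρ z * g z + (fderiv ℝ ρ z e : ℝ) * v z) := by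
  have cρ : Continuous (fun z => (ρ z : ℂ)) := Complex.continuous_ofReal.comp hρ.continuous
  have cρ' : Continuous (fun z => ((fderiv ℝ ρ z e : ℝ) : ℂ)) :=
    Complex.continuous_ofReal.comp
      ((hρ.continuous_fderiv (by simp)).clm_apply continuous_const)
  have l1 := h.1.continuousOn_mul cρ.continuousOn hΩ.isLocallyClosed
  have l2 := h.2.1.continuousOn_mul cρ.continuousOn hΩ.isLocallyClosed
  have l3 := h.1.continuousOn_mul cρ'.continuousOn hΩ.isLocallyClosed
  refine ⟨l1, l2.add l3, fun f hf => ?_⟩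
  rw [setIntegral_eq_integral_of_forall_compl_eq_zero (s := Ω),
    setIntegral_eq_integral_of_forall_compl_eq_zero (s := Ω)]
  · have i1 := integrable_mul_of_tsupport_subset l1 (hf.continuous_fderiv e)
      (hf.hasCompactSupport_fderiv e) (hf.tsupport_fderiv_subset e)
    have i2 := integrable_mul_of_tsupport_subset l2 hf.1.continuous hf.2.1 hf.2.2
    have i3 := integrable_mul_of_tsupport_subset l3 hf.1.continuous hf.2.1 hf.2.2
    have key := h.integral_eq (hf.ofReal_mul hρ)
    have e1 : ∫ z, v z * fderiv ℝ (fun z => (ρ z : ℂ) * f z) z e =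
        (∫ z, ρ z * v z * fderiv ℝ f z e) + ∫ z, (fderiv ℝ ρ z e : ℝ) * v z * f z := by
      rw [← integral_add i1 i3]
      refine integral_congr_ae (.of_forall fun z => ?_)
      simp only
      rw [fderiv_ofReal_mul (hρ.differentiable (by simp) z) (hf.1.differentiable (by simp) z)]
      ring
    have e2 : ∫ z, (ρ z * g z + (fderiv ℝ ρ z e : ℝ) * v z) * f z =
        (∫ z, g z * (ρ z * f z)) + ∫ z, (fderiv ℝ ρ z e : ℝ) * v z * f z := by
      rw [← integral_add _ i3]
      · refine integral_congr_ae (.of_forall fun z => ?_)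
        simp only
        ring
      · exact i2.congr (.of_forall fun z => by simp only; ring)
    rw [e2, neg_add, ← key, e1]
    ring
  · intro z hz; simp [hf.eq_zero_of_notMem hz]
  · intro z hz; simp [hf.fderiv_eq_zero_of_notMem e hz]

theorem IsWeakGrad.ofReal_mul {Ω : Set ℂ} (hΩ : IsOpen Ω) {v : ℂ → ℂ} {G : ℂ → ℂ × ℂ}
    (h : IsWeakGrad Ω v G) {ρ : ℂ → ℝ} (hρ : ContDiff ℝ ∞ ρ) :
    IsWeakGrad Ω (fun z => ρ z * v z) (fun z =>
      (ρ z * (G z).1 + (fderiv ℝ ρ z 1 : ℝ) * v z,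
        ρ z * (G z).2 + (fderiv ℝ ρ z Complex.I : ℝ) * v z)) := by
  rw [isWeakGrad_iff] at h ⊢
  exact ⟨h.1.ofReal_mul hΩ hρ, h.2.ofReal_mul hΩ hρ⟩

/-- If two functions differ on an open set by a smooth function, so do their weak derivatives. -/
theorem HasWeakDeriv.ae_eq_add {Ω U : Set ℂ} (hU : IsOpen U) (hUΩ : U ⊆ Ω) {e : ℂ}
    {u g v k s : ℂ → ℂ} (hu : HasWeakDeriv Ω e u g) (hv : HasWeakDeriv Ω e v k)
    (hs : ContDiffOn ℝ ∞ s U) (h : ∀ᵐ z, z ∈ U → u z = s z + v z) :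
    ∀ᵐ z, z ∈ U → g z = fderiv ℝ s z e + k z := by
  have cs' : ContinuousOn (fun z => fderiv ℝ s z e) U :=
    (hs.continuousOn_fderiv_of_isOpen hU (by simp)).clm_apply continuousOn_const
  have ls : LocallyIntegrableOn s U volume :=
    hs.continuousOn.locallyIntegrableOn hU.measurableSet
  have ls' : LocallyIntegrableOn (fun z => fderiv ℝ s z e) U volume :=
    cs'.locallyIntegrableOn hU.measurableSet
  have lg := hu.2.1.mono_set hUΩ
  have lk := hv.2.1.mono_set hUΩ
  -- Fundamental lemma of the calculus of variations: the defect of the claimed identity is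
  -- orthogonal to every real bump supported in `U`.
  have := hU.ae_eq_zero_of_integral_contDiff_smul_eq_zero
    (f := fun z => g z - fderiv ℝ s z e - k z) (μ := volume) ((lg.sub ls').sub lk) ?_
  · filter_upwards [this] with z hz hzU
    linear_combination hz hzU
  intro f hf hfc hfs
  have hF : IsTest U (fun z => (f z : ℂ)) :=
    ⟨Complex.ofRealCLM.contDiff.comp hf, hfc.comp_left (g := fun x : ℝ => (x : ℂ)) (by simp),
      (tsupport_comp_subset (g := fun x : ℝ => (x : ℂ)) (by simp) f).trans hfs⟩
  have j1 := integrable_mul_of_tsupport_subset lg hF.1.continuous hF.2.1 hF.2.2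
  have j2 := integrable_mul_of_tsupport_subset ls' hF.1.continuous hF.2.1 hF.2.2
  have j3 := integrable_mul_of_tsupport_subset lk hF.1.continuous hF.2.1 hF.2.2
  have j4 := integrable_mul_of_tsupport_subset ls (hF.continuous_fderiv e)
    (hF.hasCompactSupport_fderiv e) (hF.tsupport_fderiv_subset e)
  have j5 := integrable_mul_of_tsupport_subset (hv.1.mono_set hUΩ) (hF.continuous_fderiv e)
    (hF.hasCompactSupport_fderiv e) (hF.tsupport_fderiv_subset e)
  have j6 := integrable_mul_of_tsupport_subset ls hF.1.continuous hF.2.1 hF.2.2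
  have k1 := hu.integral_eq (hF.mono hUΩ)
  have k2 := hv.integral_eq (hF.mono hUΩ)
  -- The function `s` is smooth only on `U`, which is enough here because the support of the test
  -- function lies in `U`.
  have k3 := integral_mul_fderiv_eq_neg_fderiv_mul_of_integrable j2 j4 j6
    (fun z hz => (hs.contDiffAt (hU.mem_nhds (hF.2.2 hz))).differentiableAt (by simp))
    (fun z _ => hF.1.differentiable (by simp) z)
  have k4 : ∫ z, u z * fderiv ℝ (fun z => (f z : ℂ)) z e =
      (∫ z, s z * fderiv ℝ (fun z => (f z : ℂ)) z e) +
        ∫ z, v z * fderiv ℝ (fun z => (f z : ℂ)) z e := by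
    rw [← integral_add j4 j5]
    refine integral_congr_ae ?_
    filter_upwards [h] with z hz
    by_cases hzU : z ∈ U
    · rw [hz hzU, add_mul]
    · simp [hF.fderiv_eq_zero_of_notMem e hzU]
  have k5 : ∫ z, f z • (g z - fderiv ℝ s z e - k z) =
      (∫ z, g z * f z) - (∫ z, fderiv ℝ s z e * f z) - ∫ z, k z * f z := by
    have j12 : Integrable (fun z => g z * f z - fderiv ℝ s z e * f z) := j1.sub j2
    rw [← integral_sub j1 j2, ← integral_sub j12 j3]
    refine integral_congr_ae (.of_forall fun z => ?_)
    simp only [Complex.real_smul]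
    ring
  rw [k5]
  rw [k1, k2, k3] at k4
  linear_combination -k4

/-! ### Weighted spaces -/

/-- The density of the squared weighted norm. -/
def normDensity (w : ℂ → ℝ) (β : ℝ) (v : ℂ → ℂ) (G : ℂ → ℂ × ℂ) (z : ℂ) : ℝ :=
  w z ^ (2 * (β - 1)) * ‖v z‖ ^ 2 + w z ^ (2 * β) * (‖(G z).1‖ ^ 2 + ‖(G z).2‖ ^ 2)

theorem normDensity_nonneg {w : ℂ → ℝ} {z : ℂ} (hw : 0 < w z) (β : ℝ) (v : ℂ → ℂ)
    (G : ℂ → ℂ × ℂ) : 0 ≤ normDensity w β v G z := by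
  have h1 := Real.rpow_nonneg hw.le (2 * (β - 1))
  have h2 := Real.rpow_nonneg hw.le (2 * β)
  unfold normDensity
  positivity

/-- `v`, with weak gradient `G`, is a limit of test functions in the weighted norm. -/
def MemVWith (Ω : Set ℂ) (w : ℂ → ℝ) (β : ℝ) (v : ℂ → ℂ) (G : ℂ → ℂ × ℂ) : Prop :=
  IsWeakGrad Ω v G ∧ ∃ f : ℕ → ℂ → ℂ, (∀ n, IsTest Ω (f n)) ∧
    Tendsto (fun n => weightedNormSq Ω w β (fun z => v z - f n z) (fun z => G z - grad (f n) z))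
      atTop (𝓝 0)

theorem memV_iff {Ω : Set ℂ} {w : ℂ → ℝ} {β : ℝ} {v : ℂ → ℂ} :
    MemV Ω w β v ↔ ∃ G, MemVWith Ω w β v G := Iff.rfl

theorem aestronglyMeasurable_normDensity {Ω : Set ℂ} {w : ℂ → ℝ} (hw : Continuous w) (β : ℝ)
    {v : ℂ → ℂ} {G : ℂ → ℂ × ℂ} (hv : AEStronglyMeasurable v (volume.restrict Ω))
    (h1 : AEStronglyMeasurable (fun z => (G z).1) (volume.restrict Ω))
    (h2 : AEStronglyMeasurable (fun z => (G z).2) (volume.restrict Ω)) :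
    AEStronglyMeasurable (normDensity w β v G) (volume.restrict Ω) := by
  have m (p : ℝ) : AEStronglyMeasurable (fun z => w z ^ p) (volume.restrict Ω) :=
    (hw.measurable.pow_const p).aestronglyMeasurable
  exact ((m _).mul (hv.norm.pow 2)).add ((m _).mul ((h1.norm.pow 2).add (h2.norm.pow 2)))

/-- Powers of the weight may be singular on the boundary, as those of `r` are at `O`, but they are
continuous on the compact support of `f` inside `Ω`. -/
theorem IsTest.integrable_normDensity {Ω : Set ℂ} {w : ℂ → ℝ} (hw : Continuous w)
    (hpos : ∀ z ∈ Ω, 0 < w z) (β : ℝ) {f : ℂ → ℂ} (hf : IsTest Ω f) :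
    Integrable (normDensity w β f (grad f)) := by
  have hp (p : ℝ) : ContinuousOn (fun z => w z ^ p) (tsupport f) :=
    hw.continuousOn.rpow_const fun z hz => .inl (hpos z (hf.2.2 hz)).ne'
  have hc : ContinuousOn (normDensity w β f (grad f)) (tsupport f) :=
    ((hp _).mul (hf.1.continuous.norm.pow 2).continuousOn).add
      ((hp _).mul (((hf.continuous_fderiv 1).norm.pow 2).add
        ((hf.continuous_fderiv Complex.I).norm.pow 2)).continuousOn)
  refine (integrableOn_iff_integrable_of_support_subset ?_).1
    (hc.integrableOn_compact hf.2.1)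
  intro z hz
  by_contra h
  have h1 : f z = 0 := image_eq_zero_of_notMem_tsupport h
  have h2 : fderiv ℝ f z = 0 :=
    image_eq_zero_of_notMem_tsupport fun h' => h (_root_.tsupport_fderiv_subset ℝ h')
  exact hz (by simp [normDensity, grad, h1, h2])

theorem normDensity_le_two_mul {w : ℂ → ℝ} {z : ℂ} (hw : 0 < w z) (β : ℝ) (v f : ℂ → ℂ)
    (G F : ℂ → ℂ × ℂ) : normDensity w β v G z ≤
      2 * normDensity w β (fun z => v z - f z) (fun z => G z - F z) z +
        2 * normDensity w β f F z := by
  have key (a b : ℂ) : ‖a‖ ^ 2 ≤ 2 * ‖a - b‖ ^ 2 + 2 * ‖b‖ ^ 2 := by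
    have h : ‖a‖ ≤ ‖a - b‖ + ‖b‖ := by simpa using norm_add_le (a - b) b
    nlinarith [sq_nonneg (‖a - b‖ - ‖b‖), norm_nonneg a, norm_nonneg b, norm_nonneg (a - b)]
  have h1 := mul_le_mul_of_nonneg_left (key (v z) (f z)) (Real.rpow_nonneg hw.le (2 * (β - 1)))
  have h2 := mul_le_mul_of_nonneg_left (key (G z).1 (F z).1) (Real.rpow_nonneg hw.le (2 * β))
  have h3 := mul_le_mul_of_nonneg_left (key (G z).2 (F z).2) (Real.rpow_nonneg hw.le (2 * β))
  simp only [normDensity, Prod.fst_sub, Prod.snd_sub]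
  linarith

/-- One approximating test function at finite distance from `v` suffices, since its own norm is
finite. -/
theorem MemVWith.integrableOn {Ω : Set ℂ} (hΩ : IsOpen Ω) {w : ℂ → ℝ} (hw : Continuous w)
    (hpos : ∀ z ∈ Ω, 0 < w z) {β : ℝ} {v : ℂ → ℂ} {G : ℂ → ℂ × ℂ} (h : MemVWith Ω w β v G) :
    IntegrableOn (normDensity w β v G) Ω := by
  obtain ⟨⟨lv, l1, l2, -⟩, f, hf, hlim⟩ := h
  obtain ⟨n, hn⟩ := (hlim.eventually (gt_mem_nhds ENNReal.zero_lt_top)).exists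
  have mf {g : ℂ → ℂ} (hg : Continuous g) : AEStronglyMeasurable g (volume.restrict Ω) :=
    hg.aestronglyMeasurable
  have i1 : IntegrableOn
      (normDensity w β (fun z => v z - f n z) (fun z => G z - grad (f n) z)) Ω := by
    refine ⟨aestronglyMeasurable_normDensity hw β
      (lv.aestronglyMeasurable.sub (mf (hf n).1.continuous))
      (l1.aestronglyMeasurable.sub (mf ((hf n).continuous_fderiv 1)))
      (l2.aestronglyMeasurable.sub (mf ((hf n).continuous_fderiv Complex.I))), ?_⟩
    rw [hasFiniteIntegral_iff_ofReal]
    · exact hn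
    · filter_upwards [ae_restrict_mem hΩ.measurableSet] with z hz
      exact normDensity_nonneg (hpos z hz) _ _ _
  have i2 := ((hf n).integrable_normDensity hw hpos β).integrableOn (s := Ω)
  refine ((i1.const_mul 2).add (i2.const_mul 2)).mono'
    (aestronglyMeasurable_normDensity hw β lv.aestronglyMeasurable l1.aestronglyMeasurable
      l2.aestronglyMeasurable) ?_
  filter_upwards [ae_restrict_mem hΩ.measurableSet] with z hz
  rw [Real.norm_of_nonneg (normDensity_nonneg (hpos z hz) _ _ _)]
  exact normDensity_le_two_mul (hpos z hz) _ _ _ _ _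

/-- The gradient of a product with a real factor. -/
def mulGrad (ρ : ℂ → ℝ) (v : ℂ → ℂ) (G : ℂ → ℂ × ℂ) (z : ℂ) : ℂ × ℂ :=
  (ρ z * (G z).1 + (fderiv ℝ ρ z 1 : ℝ) * v z,
    ρ z * (G z).2 + (fderiv ℝ ρ z Complex.I : ℝ) * v z)

/-- `ρ` is a smooth multiplier from the weighted space of exponent `β` to that of exponent
`β'`. -/
structure IsMultiplier (Ω : Set ℂ) (w : ℂ → ℝ) (β β' : ℝ) (ρ : ℂ → ℝ) (C : ℝ) : Prop where
  contDiff : ContDiff ℝ ∞ ρ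
  value_le : ∀ z ∈ Ω, w z ^ (2 * (β' - 1)) * ρ z ^ 2 ≤ C * w z ^ (2 * (β - 1))
  slope_le : ∀ z ∈ Ω, w z ^ (2 * β') * ρ z ^ 2 ≤ C * w z ^ (2 * β)
  deriv_le : ∀ z ∈ Ω, w z ^ (2 * β') * ((fderiv ℝ ρ z 1) ^ 2 + (fderiv ℝ ρ z Complex.I) ^ 2) ≤
    C * w z ^ (2 * (β - 1))

/-- The constant is `3 = 1 + 2`: the value term of `ρ v` costs `C`, and squaring the product rule
costs `2 C` for each of `ρ ∇v` and `v ∇ρ`, the latter again a multiple of `|v|²`. -/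
theorem IsMultiplier.normDensity_le {Ω : Set ℂ} {w : ℂ → ℝ} {β β' : ℝ} {ρ : ℂ → ℝ} {C : ℝ}
    (h : IsMultiplier Ω w β β' ρ C) {z : ℂ} (hz : z ∈ Ω) (hw : 0 < w z) (v : ℂ → ℂ)
    (G : ℂ → ℂ × ℂ) :
    normDensity w β' (fun z => ρ z * v z) (mulGrad ρ v G) z ≤ 3 * C * normDensity w β v G z := by
  have key (a b : ℝ) (x y : ℂ) : ‖(a : ℂ) * x + b * y‖ ^ 2 ≤
      2 * (a ^ 2 * ‖x‖ ^ 2) + 2 * (b ^ 2 * ‖y‖ ^ 2) := by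
    have h : ‖(a : ℂ) * x + b * y‖ ≤ |a| * ‖x‖ + |b| * ‖y‖ := by
      refine (norm_add_le _ _).trans_eq ?_
      simp
    have h2 : ‖(a : ℂ) * x + b * y‖ ^ 2 ≤ (|a| * ‖x‖ + |b| * ‖y‖) ^ 2 := by gcongr
    have h3 : (|a| * ‖x‖ + |b| * ‖y‖) ^ 2 ≤ 2 * (|a| * ‖x‖) ^ 2 + 2 * (|b| * ‖y‖) ^ 2 := by
      nlinarith [sq_nonneg (|a| * ‖x‖ - |b| * ‖y‖)]
    simpa only [mul_pow, sq_abs] using h2.trans h3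
  have p1 := Real.rpow_nonneg hw.le (2 * β')
  have p2 := Real.rpow_pos_of_pos hw (2 * β)
  have p3 := Real.rpow_pos_of_pos hw (2 * (β - 1))
  have p4 := Real.rpow_nonneg hw.le (2 * (β' - 1))
  have hC : 0 ≤ C := by
    by_contra! hC
    have := h.slope_le z hz
    nlinarith [mul_nonneg p1 (sq_nonneg (ρ z)), mul_pos (neg_pos.2 hC) p2]
  have k1 := mul_le_mul_of_nonneg_left
    (key (ρ z) (fderiv ℝ ρ z 1) (G z).1 (v z)) p1
  have k2 := mul_le_mul_of_nonneg_left
    (key (ρ z) (fderiv ℝ ρ z Complex.I) (G z).2 (v z)) p1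
  have n1 := sq_nonneg ‖v z‖
  have n2 : 0 ≤ ‖(G z).1‖ ^ 2 + ‖(G z).2‖ ^ 2 := by positivity
  have k3 := mul_le_mul_of_nonneg_right (h.value_le z hz) n1
  have k4 := mul_le_mul_of_nonneg_right (h.slope_le z hz) n2
  have k5 := mul_le_mul_of_nonneg_right (h.deriv_le z hz) n1
  have k6 : 0 ≤ C * (w z ^ (2 * β) * (‖(G z).1‖ ^ 2 + ‖(G z).2‖ ^ 2)) :=
    mul_nonneg hC (mul_nonneg p2.le n2)
  simp only [normDensity, mulGrad, norm_mul, Complex.norm_real, Real.norm_eq_abs, mul_pow, sq_abs]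
  linarith

/-- Multiplication by `ρ` is bounded between the two norms and preserves test functions, so `ρ f n`
approximates `ρ v`. -/
theorem IsMultiplier.memVWith {Ω : Set ℂ} (hΩ : IsOpen Ω) {w : ℂ → ℝ}
    (hpos : ∀ z ∈ Ω, 0 < w z) {β β' : ℝ} {ρ : ℂ → ℝ} {C : ℝ}
    (h : IsMultiplier Ω w β β' ρ C) {v : ℂ → ℂ} {G : ℂ → ℂ × ℂ} (hv : MemVWith Ω w β v G) :
    MemVWith Ω w β' (fun z => ρ z * v z) (mulGrad ρ v G) := by
  obtain ⟨hG, f, hf, hlim⟩ := hv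
  refine ⟨hG.ofReal_mul hΩ h.contDiff, fun n z => ρ z * f n z,
    fun n => (hf n).ofReal_mul h.contDiff, ?_⟩
  have hlim' := ENNReal.Tendsto.const_mul hlim (.inr (ENNReal.ofReal_ne_top (r := 3 * C)))
  rw [mul_zero] at hlim'
  refine tendsto_of_tendsto_of_tendsto_of_le_of_le tendsto_const_nhds hlim'
    (fun _ => bot_le) fun n => ?_
  simp only [weightedNormSq]
  rw [← lintegral_const_mul' _ _ ENNReal.ofReal_ne_top]
  refine lintegral_mono_ae ?_
  filter_upwards [ae_restrict_mem hΩ.measurableSet] with z hz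
  refine le_of_le_of_eq ?_ (ENNReal.ofReal_mul' (normDensity_nonneg (hpos z hz) β (fun z => v z - f n z)
    (fun z => G z - grad (f n) z)))
  refine ENNReal.ofReal_le_ofReal (le_trans (le_of_eq ?_) (h.normDensity_le hz (hpos z hz)
    (fun z => v z - f n z) (fun z => G z - grad (f n) z)))
  rw [(hf n).grad_ofReal_mul h.contDiff]
  simp only [normDensity, mulGrad, Prod.fst_sub, Prod.snd_sub]
  congr 4
  · ring_nf
  · congr 3
    ring
  · congr 2
    ring

/-- The integrand of the form on the pair of spaces of exponents `β` and `-β` is integrable. -/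
theorem integrableOn_form {Ω : Set ℂ} (hΩ : IsOpen Ω) {w : ℂ → ℝ} (hw : Continuous w)
    (hpos : ∀ z ∈ Ω, 0 < w z) {β : ℝ} {u v : ℂ → ℂ} {G H : ℂ → ℂ × ℂ}
    (hu : MemVWith Ω w β u G) (hv : MemVWith Ω w (-β) v H) {σ : ℂ → ℝ} (hσ : Measurable σ)
    {S : ℝ} (hS : ∀ z, |σ z| ≤ S) :
    IntegrableOn (fun z => (σ z : ℂ) *
      ((G z).1 * starRingEnd ℂ (H z).1 + (G z).2 * starRingEnd ℂ (H z).2)) Ω := by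
  have i := ((hu.integrableOn hΩ hw hpos).add (hv.integrableOn hΩ hw hpos)).const_mul S
  have mG1 := hu.1.2.1.aestronglyMeasurable
  have mG2 := hu.1.2.2.1.aestronglyMeasurable
  have mH1 := Complex.continuous_conj.comp_aestronglyMeasurable hv.1.2.1.aestronglyMeasurable
  have mH2 := Complex.continuous_conj.comp_aestronglyMeasurable hv.1.2.2.1.aestronglyMeasurable
  refine i.mono' ((Complex.measurable_ofReal.comp hσ).aestronglyMeasurable.mul
    ((mG1.mul mH1).add (mG2.mul mH2))) ?_
  filter_upwards [ae_restrict_mem hΩ.measurableSet] with z hz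
  have hz := hpos z hz
  have hS0 : 0 ≤ S := (abs_nonneg _).trans (hS z)
  rw [norm_mul, Complex.norm_real, Real.norm_eq_abs]
  refine mul_le_mul (hS z) ?_ (norm_nonneg _) hS0
  have p1 := Real.rpow_pos_of_pos hz (2 * β)
  have p2 : w z ^ (2 * -β) = (w z ^ (2 * β))⁻¹ := by rw [← Real.rpow_neg hz.le]; ring_nf
  have p3 := Real.rpow_nonneg hz.le (2 * (β - 1))
  have p4 := Real.rpow_nonneg hz.le (2 * (-β - 1))
  -- Young's inequality with the reciprocal weights `w^{2β}` and `w^{-2β}`; this is the duality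
  -- between exponents `β` and `-β`.
  have key (a b : ℝ) : a * b ≤ w z ^ (2 * β) * a ^ 2 + w z ^ (2 * -β) * b ^ 2 := by
    rw [p2]
    set t := w z ^ (2 * β)
    have h1 : 0 ≤ t⁻¹ * (t * a - b) ^ 2 := by positivity
    have h2 : t⁻¹ * (t * a - b) ^ 2 = t * a ^ 2 + t⁻¹ * b ^ 2 - 2 * (a * b) := by
      field_simp
      ring
    have h3 : 0 ≤ t * a ^ 2 + t⁻¹ * b ^ 2 := by positivity
    linarith
  refine (norm_add_le _ _).trans ?_
  simp only [norm_mul, RCLike.norm_conj, Pi.add_apply, normDensity]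
  have k1 := key ‖(G z).1‖ ‖(H z).1‖
  have k2 := key ‖(G z).2‖ ‖(H z).2‖
  have k3 := mul_nonneg p3 (sq_nonneg ‖u z‖)
  have k4 := mul_nonneg p4 (sq_nonneg ‖v z‖)
  linarith

/-! ### The radial cut-off functions -/

/-- The dilated radial cut-off function `z ↦ ψ (r / t)`. -/
def radialCutoff (ψ : ℝ → ℝ) (t : ℝ) (z : ℂ) : ℝ := ψ (‖z‖ / t)

/-- The factor `k` in `∇ ψ (r / t) = k x`. -/
def cutoffSlope (ψ : ℝ → ℝ) (t : ℝ) (z : ℂ) : ℝ := deriv ψ (‖z‖ / t) / (t * ‖z‖)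

theorem IsCutoff.deriv_eq_zero {ψ : ℝ → ℝ} (hψ : IsCutoff ψ) {r : ℝ} (hr : r ∉ Set.Icc (1 : ℝ) 2) :
    deriv ψ r = 0 := by
  obtain ⟨-, -, h1, h2⟩ := hψ
  rw [Set.mem_Icc, not_and_or, not_le, not_le] at hr
  rcases hr with hr | hr
  · have : ψ =ᶠ[𝓝 r] fun _ => 1 := by
      filter_upwards [gt_mem_nhds hr] with x hx using h1 x hx.le
    rw [this.deriv_eq, deriv_const]
  · have : ψ =ᶠ[𝓝 r] fun _ => 0 := by
      filter_upwards [lt_mem_nhds hr] with x hx using h2 x hx.le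
    rw [this.deriv_eq, deriv_const]

theorem IsCutoff.exists_deriv_le {ψ : ℝ → ℝ} (hψ : IsCutoff ψ) : ∃ M, 0 ≤ M ∧ ∀ r, |deriv ψ r| ≤ M := by
  obtain ⟨M, hM⟩ := isCompact_Icc.exists_bound_of_continuousOn (s := Set.Icc (1 : ℝ) 2)
    (hψ.1.continuous_deriv (by simp)).continuousOn
  refine ⟨M, (norm_nonneg _).trans (hM 1 (by norm_num)), fun r => ?_⟩
  by_cases hr : r ∈ Set.Icc (1 : ℝ) 2
  · exact hM r hr
  · rw [hψ.deriv_eq_zero hr, abs_zero]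
    exact (norm_nonneg _).trans (hM 1 (by norm_num))

/-- The norm is not smooth at the origin, but the cut-off is constant there. -/
theorem IsCutoff.contDiff_radialCutoff {ψ : ℝ → ℝ} (hψ : IsCutoff ψ) {t : ℝ} (ht : 0 < t) :
    ContDiff ℝ ∞ (radialCutoff ψ t) := by
  rw [contDiff_iff_contDiffAt]
  intro z
  by_cases hz : z = 0
  · subst hz
    have : radialCutoff ψ t =ᶠ[𝓝 0] fun _ => 1 := by
      filter_upwards [Metric.ball_mem_nhds (0 : ℂ) ht] with z hz
      rw [mem_ball_zero_iff] at hz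
      exact hψ.2.2.1 _ ((div_le_one ht).2 hz.le)
    exact contDiffAt_const.congr_of_eventuallyEq this
  · exact hψ.1.contDiffAt.comp z ((contDiffAt_norm ℝ hz).div_const t)

theorem IsCutoff.fderiv_radialCutoff {ψ : ℝ → ℝ} (hψ : IsCutoff ψ) {t : ℝ} {z : ℂ}
    (hz : z ≠ 0) (e : ℂ) :
    fderiv ℝ (radialCutoff ψ t) z e = cutoffSlope ψ t z * (z.re * e.re + z.im * e.im) := by
  have h1 : HasFDerivAt (fun z : ℂ => ‖z‖ / t) ((‖z‖⁻¹ / t) • innerSL ℝ z) z := by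
    have h := (hasStrictFDerivAt_norm_sq z).hasFDerivAt.sqrt (by simpa using hz)
    simp only [Real.sqrt_sq (norm_nonneg _)] at h
    convert! h.mul_const t⁻¹ using 1
    ext e
    simp
    ring
  have h2 := ((hψ.1.differentiable (by simp) (‖z‖ / t)).hasDerivAt).comp_hasFDerivAt z h1
  have h3 : HasFDerivAt (radialCutoff ψ t) _ z := h2
  rw [h3.fderiv]
  simp [cutoffSlope, Complex.inner]
  ring

/-! ### The singular functions -/

/-- The function `r^{i s} Φ(θ)`, for a smooth function `Φ`. -/
def angularWave (s : ℝ) (Φ : ℝ → ℝ) (z : ℂ) : ℂ :=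
  Complex.exp (Complex.I * s * (Complex.log z).re) * Φ (Complex.log z).im

/-- The wave is a smooth function of `log z`. The derivative of `log` at `z` in the direction `z` is
`z⁻¹ z = 1`, which is real: the angle does not move and `Φ` is not differentiated. Thus the wave is
an eigenfunction of `r ∂ᵣ`. -/
theorem contDiffAt_fderiv_angularWave (s : ℝ) {Φ : ℝ → ℝ} (hΦ : ContDiff ℝ ∞ Φ) {z : ℂ}
    (hz : z ∈ Complex.slitPlane) :
    ContDiffAt ℝ ∞ (angularWave s Φ) z ∧
      fderiv ℝ (angularWave s Φ) z z = Complex.I * s * angularWave s Φ z := by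
  have hre (x : ℂ) : HasFDerivAt (fun x : ℂ => (x.re : ℂ))
      (Complex.ofRealCLM.comp Complex.reCLM) x :=
    (Complex.ofRealCLM.comp Complex.reCLM).hasFDerivAt
  have c1 : ContDiff ℝ ∞ (fun x : ℂ => Complex.exp (Complex.I * s * x.re)) :=
    (Complex.contDiff_exp (𝕜 := ℝ)).comp
      (contDiff_const.mul (Complex.ofRealCLM.comp Complex.reCLM).contDiff)
  have c2 : ContDiff ℝ ∞ (fun x : ℂ => (Φ x.im : ℂ)) :=
    Complex.ofRealCLM.contDiff.comp (hΦ.comp Complex.imCLM.contDiff)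
  have c3 : ContDiffAt ℝ ∞ Complex.log z := (Complex.contDiffAt_log hz).restrict_scalars ℝ
  refine ⟨(c1.mul c2).contDiffAt.comp z c3, ?_⟩
  have hlog : HasFDerivAt Complex.log
      ((ContinuousLinearMap.toSpanSingleton ℂ z⁻¹).restrictScalars ℝ) z :=
    (Complex.hasStrictDerivAt_log hz).hasDerivAt.hasFDerivAt.restrictScalars ℝ
  have d1 := ((hre (Complex.log z)).const_mul (Complex.I * s)).cexp
  have d2 : HasFDerivAt (fun x : ℂ => (Φ x.im : ℂ)) (Complex.ofRealCLM.comp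
      ((deriv Φ (Complex.log z).im) • Complex.imCLM)) (Complex.log z) :=
    Complex.ofRealCLM.hasFDerivAt.comp _
      (((hΦ.differentiable (by simp) _).hasDerivAt).comp_hasFDerivAt _
        Complex.imCLM.hasFDerivAt)
  have d3 : HasFDerivAt (angularWave s Φ) _ z := (d1.mul d2).comp z hlog
  rw [d3.fderiv]
  have hz0 : z ≠ 0 := Complex.slitPlane_ne_zero hz
  simp [angularWave, hz0]
  ring

theorem sector_subset {a b : ℝ} (ha : 0 ≤ a) (hb : b ≤ Real.pi) : sector a b ⊆ Xi := by
  rintro z ⟨hz, h1, h2⟩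
  by_contra h
  rcases (not_lt.1 h : z.im ≤ 0).lt_or_eq with h | h
  · linarith [Complex.arg_neg_iff.2 h]
  · rcases le_or_gt 0 z.re with h3 | h3
    · linarith [Complex.arg_eq_zero_iff.2 ⟨h3, h⟩]
    · linarith [Complex.arg_eq_pi_iff.2 ⟨h3, h⟩]

theorem Xi_subset_slitPlane : Xi ⊆ Complex.slitPlane := fun _ hz => .inr (ne_of_gt hz)

theorem isOpen_sector {a b : ℝ} (ha : 0 ≤ a) (hb : b ≤ Real.pi) : IsOpen (sector a b) := by
  rw [isOpen_iff_mem_nhds]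
  intro z hz
  have hs := Xi_subset_slitPlane (sector_subset ha hb hz)
  have hc := Complex.continuousAt_arg hs
  filter_upwards [hc.eventually (lt_mem_nhds hz.2.1), hc.eventually (gt_mem_nhds hz.2.2),
    isOpen_ne.mem_nhds hz.1] with x h1 h2 h3 using ⟨h3, h1, h2⟩

theorem singular_eq_angularWave {s μ c : ℝ} {Φ : ℝ → ℝ} {z : ℂ} (hz : z ≠ 0)
    (h : phi μ c z.arg = Φ z.arg) : singular s μ c z = angularWave s Φ z := by
  have : (‖z‖ : ℂ) ≠ 0 := by simpa using hz
  rw [singular, angularWave, h, Complex.cpow_def_of_ne_zero this, Complex.log_re, Complex.log_im,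
    ← Complex.ofReal_log (norm_nonneg z)]
  ring_nf

/-- Since `phi` is defined by two formulas that meet at `π/4`, smoothness is obtained on each open
sector separately, where `phi` agrees with a function smooth on all of `ℝ`. -/
theorem singular_contDiffOn_fderiv {a b : ℝ} (ha : 0 ≤ a) (hb : b ≤ Real.pi) {μ c : ℝ} {Φ : ℝ → ℝ}
    (hΦ : ContDiff ℝ ∞ Φ) (h : ∀ θ, a < θ → θ < b → phi μ c θ = Φ θ) (s : ℝ) :
    ContDiffOn ℝ ∞ (singular s μ c) (sector a b) ∧
      ∀ z ∈ sector a b, fderiv ℝ (singular s μ c) z z = Complex.I * s * singular s μ c z := by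
  have heq : ∀ z ∈ sector a b, singular s μ c z = angularWave s Φ z := fun z hz =>
    singular_eq_angularWave hz.1 (h _ hz.2.1 hz.2.2)
  have hs : ∀ z ∈ sector a b, z ∈ Complex.slitPlane := fun z hz =>
    Xi_subset_slitPlane (sector_subset ha hb hz)
  refine ⟨ContDiffOn.congr (fun z hz =>
    (contDiffAt_fderiv_angularWave s hΦ (hs z hz)).1.contDiffWithinAt) heq, fun z hz => ?_⟩
  have : singular s μ c =ᶠ[𝓝 z] angularWave s Φ := by
    filter_upwards [(isOpen_sector ha hb).mem_nhds hz] with x hx using heq x hx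
  rw [this.fderiv_eq, heq z hz]
  exact (contDiffAt_fderiv_angularWave s hΦ (hs z hz)).2

theorem singular_lower (s μ c : ℝ) :
    ContDiffOn ℝ ∞ (singular s μ c) (sector 0 (Real.pi / 4)) ∧ ∀ z ∈ sector 0 (Real.pi / 4),
      fderiv ℝ (singular s μ c) z z = Complex.I * s * singular s μ c z := by
  refine singular_contDiffOn_fderiv le_rfl (by linarith [Real.pi_pos])
    (Φ := fun θ => c * (Real.sinh (μ * θ) / Real.sinh (μ * (Real.pi / 4)))) ?_ ?_ s
  · exact contDiff_const.mul ((Real.contDiff_sinh.comp (contDiff_const.mul contDiff_id)).div_const _)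
  · intro θ _ h
    rw [phi, if_pos h.le]

theorem singular_upper (s μ c : ℝ) :
    ContDiffOn ℝ ∞ (singular s μ c) (sector (Real.pi / 4) Real.pi) ∧
      ∀ z ∈ sector (Real.pi / 4) Real.pi,
        fderiv ℝ (singular s μ c) z z = Complex.I * s * singular s μ c z := by
  refine singular_contDiffOn_fderiv (by positivity) le_rfl
    (Φ := fun θ => c * (Real.sinh (μ * (Real.pi - θ)) / Real.sinh (μ * (3 * Real.pi / 4)))) ?_ ?_ s
  · exact contDiff_const.mul ((Real.contDiff_sinh.comp
      (contDiff_const.mul (contDiff_const.sub contDiff_id))).div_const _)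
  · intro θ h _
    rw [phi, if_neg h.not_ge]

theorem exists_phi_le (μ c : ℝ) : ∃ L, 0 ≤ L ∧ ∀ z : ℂ, |phi μ c z.arg| ≤ L := by
  obtain ⟨L₁, h₁⟩ := isCompact_Icc.exists_bound_of_continuousOn (s := Set.Icc (-Real.pi) Real.pi)
    (f := fun θ => c * (Real.sinh (μ * θ) / Real.sinh (μ * (Real.pi / 4)))) (by fun_prop)
  obtain ⟨L₂, h₂⟩ := isCompact_Icc.exists_bound_of_continuousOn (s := Set.Icc (-Real.pi) Real.pi)
    (f := fun θ => c * (Real.sinh (μ * (Real.pi - θ)) / Real.sinh (μ * (3 * Real.pi / 4))))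
    (by fun_prop)
  refine ⟨max L₁ L₂, ?_, fun z => ?_⟩
  · exact (norm_nonneg _).trans ((h₁ 0 ⟨by linarith [Real.pi_pos], Real.pi_pos.le⟩).trans
      (le_max_left _ _))
  · have hz : z.arg ∈ Set.Icc (-Real.pi) Real.pi := ⟨(Complex.neg_pi_lt_arg z).le, Complex.arg_le_pi z⟩
    rw [phi]
    split_ifs
    · exact (h₁ _ hz).trans (le_max_left _ _)
    · exact (h₂ _ hz).trans (le_max_right _ _)

/-- The oscillating factor `r^{i μ}`, as a number of modulus `1`. -/
theorem exists_singular_eq {z : ℂ} (hz : z ≠ 0) (μ c : ℝ) : ∃ E : ℂ, ‖E‖ = 1 ∧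
    singular μ μ c z = E * phi μ c z.arg ∧
    singular (-μ) μ c z = starRingEnd ℂ E * phi μ c z.arg := by
  have h0 : (‖z‖ : ℂ) ≠ 0 := by simpa using hz
  refine ⟨(‖z‖ : ℂ) ^ (Complex.I * μ), ?_, rfl, ?_⟩
  · rw [Complex.norm_cpow_eq_rpow_re_of_pos (norm_pos_iff.2 hz)]
    simp
  · rw [singular, Complex.cpow_def_of_ne_zero h0, Complex.cpow_def_of_ne_zero h0,
      ← Complex.exp_conj, ← Complex.ofReal_log (norm_nonneg z)]
    simp

/-- The cross terms form `w - conj w`, with `w = conj A * B * E²` up to the factor `φ²`. This is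
purely imaginary, so after multiplication by `i μ` it is real and drops out of the imaginary part.
-/
theorem im_conj_mul_flux {E : ℂ} (hE : ‖E‖ = 1) (A B : ℂ) (μ φ : ℝ) :
    (starRingEnd ℂ (A * (starRingEnd ℂ E * φ) + B * (E * φ)) *
      (Complex.I * μ * (B * (E * φ) - A * (starRingEnd ℂ E * φ)))).im =
    μ * φ ^ 2 * (‖B‖ ^ 2 - ‖A‖ ^ 2) := by
  have h : E.re ^ 2 + E.im ^ 2 = 1 := by
    have h := Complex.sq_norm E
    rw [hE, Complex.normSq_apply] at h
    linarith
  rw [Complex.sq_norm, Complex.sq_norm, Complex.normSq_apply, Complex.normSq_apply]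
  simp
  linear_combination (μ * φ ^ 2 * (B.re * B.re + B.im * B.im - (A.re * A.re + A.im * A.im))) * h

/-! ### The main term -/

/-- The angular density of the flux. -/
def angularFlux (σp σm c : ℝ) (θ : ℝ) : ℝ :=
  (Set.Ioo 0 Real.pi).indicator
    (fun θ => mu σp σm * (sigmaAngle σp σm θ * phi (mu σp σm) c θ ^ 2)) θ

theorem integral_angularFlux {σp σm c : ℝ} (h : IsNormalized σp σm c) :
    ∫ θ in Set.Ioo (-Real.pi) Real.pi, angularFlux σp σm c θ = 1 := by
  unfold angularFlux
  rw [setIntegral_indicator measurableSet_Ioo,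
    Set.inter_eq_self_of_subset_right (Set.Ioo_subset_Ioo_left (by linarith [Real.pi_pos])),
    ← integral_Ioc_eq_integral_Ioo, ← intervalIntegral.integral_of_le Real.pi_pos.le,
    intervalIntegral.integral_const_mul]
  exact h

theorem IsCutoff.integral_deriv {ψ : ℝ → ℝ} (hψ : IsCutoff ψ) {t : ℝ} (ht : 0 < t) :
    ∫ r in Set.Ioi (0 : ℝ), deriv ψ (r / t) / t = -1 := by
  have h1 : ∫ r in Set.Ioi (0 : ℝ), deriv ψ (r / t) / t =
      ∫ r in Set.Ioc (0 : ℝ) (2 * t), deriv ψ (r / t) / t := by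
    apply setIntegral_eq_of_subset_of_forall_sdiff_eq_zero measurableSet_Ioi
      Set.Ioc_subset_Ioi_self
    rintro r ⟨hr1, hr2⟩
    rw [hψ.deriv_eq_zero, zero_div]
    intro h
    exact hr2 ⟨hr1, (div_le_iff₀ ht).1 h.2⟩
  rw [h1, ← intervalIntegral.integral_of_le (by positivity),
    intervalIntegral.integral_eq_sub_of_hasDerivAt (f := fun r => ψ (r / t))]
  · simp only [zero_div]
    rw [mul_div_assoc, div_self ht.ne', hψ.2.2.1 0 (by norm_num), hψ.2.2.2 _ (by norm_num)]
    norm_num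
  · intro r _
    have := ((hψ.1.differentiable (by simp) (r / t)).hasDerivAt).comp r
      ((hasDerivAt_id r).div_const t)
    simpa [div_eq_mul_inv, Function.comp_def] using this
  · have := hψ.1.continuous_deriv (by simp)
    exact Continuous.intervalIntegrable (by fun_prop) _ _

/-- In polar coordinates the Jacobian `r` cancels the `1/r` of `cutoffSlope`, and the integral
factors into `∫ (ψ(r/t))' dr = -1` and the normalization integral of `φ`. The result does not depend
on `t`. -/
theorem integral_cutoffSlope_mul_angularFlux {σp σm c : ℝ} (h : IsNormalized σp σm c) {ψ : ℝ → ℝ}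
    (hψ : IsCutoff ψ) {t : ℝ} (ht : 0 < t) :
    ∫ z : ℂ, cutoffSlope ψ t z * angularFlux σp σm c z.arg = -1 := by
  rw [← Complex.integral_comp_polarCoord_symm, polarCoord_target]
  have : ∀ p ∈ Set.Ioi (0 : ℝ) ×ˢ Set.Ioo (-Real.pi) Real.pi,
      p.1 • (cutoffSlope ψ t (Complex.polarCoord.symm p) *
        angularFlux σp σm c (Complex.polarCoord.symm p).arg) =
      (deriv ψ (p.1 / t) / t) * angularFlux σp σm c p.2 := by
    rintro ⟨r, θ⟩ ⟨hr, hθ⟩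
    simp only [Set.mem_Ioi] at hr
    have h1 : ‖Complex.polarCoord.symm (r, θ)‖ = r := by
      rw [Complex.norm_polarCoord_symm, abs_of_pos hr]
    have h2 : (Complex.polarCoord.symm (r, θ)).arg = θ := by
      rw [Complex.polarCoord_symm_apply]
      push_cast
      exact Complex.arg_mul_cos_add_sin_mul_I hr ⟨hθ.1, hθ.2.le⟩
    rw [h2, cutoffSlope, h1, smul_eq_mul]
    have := hr.ne'
    field_simp
  rw [setIntegral_congr_fun (measurableSet_Ioi.prod measurableSet_Ioo) this, Measure.volume_eq_prod,
    setIntegral_prod_mul (fun r => deriv ψ (r / t) / t) (angularFlux σp σm c),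
    hψ.integral_deriv ht, integral_angularFlux h]
  norm_num

/-- The ray lies in the line `x = y`, a proper real subspace. Hence it is harmless that the gradient
of the waves is known only in the open sectors. -/
theorem ae_arg_ne : ∀ᵐ z : ℂ, z.arg ≠ Real.pi / 4 := by
  have h0 : volume ((LinearMap.ker (Complex.reLm - Complex.imLm) : Submodule ℝ ℂ) : Set ℂ) = 0 := by
    refine Measure.addHaar_submodule _ _ fun h => ?_
    have : (1 : ℂ) ∈ LinearMap.ker (Complex.reLm - Complex.imLm) := by rw [h]; trivial
    simp at this
  refine measure_mono_null (fun z hz => ?_) h0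
  have hz : z.arg = Real.pi / 4 := by simpa using hz
  have h1 := Complex.norm_mul_cos_arg z
  have h2 := Complex.norm_mul_sin_arg z
  rw [hz, Real.cos_pi_div_four] at h1
  rw [hz, Real.sin_pi_div_four] at h2
  simp [← h1, ← h2]

/-! ### The flux of a solution -/

/-- The density of the flux `Im (σ ū ∇u · k x)` of a function `u` with gradient `G`. -/
def fluxDensity (σ k : ℂ → ℝ) (u : ℂ → ℂ) (G : ℂ → ℂ × ℂ) (z : ℂ) : ℝ :=
  σ z * (k z * (starRingEnd ℂ (u z) * (z.re * (G z).1 + z.im * (G z).2)).im)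

/-- The flux of an element of the kernel vanishes, by testing with `ρ u`. -/
theorem MemKer.integral_fluxDensity {Ω : Set ℂ} (hΩ : IsOpen Ω) {w : ℂ → ℝ} (hw : Continuous w)
    (hpos : ∀ z ∈ Ω, 0 < w z) {β : ℝ} {σ : ℂ → ℝ} (hσ : Measurable σ) {S : ℝ}
    (hS : ∀ z, |σ z| ≤ S) {u : ℂ → ℂ} {G : ℂ → ℂ × ℂ} (hu : MemKer Ω σ w β u)
    (hG : MemVWith Ω w β u G) {ρ : ℂ → ℝ} {C : ℝ} (hρ : IsMultiplier Ω w β (-β) ρ C) {k : ℂ → ℝ}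
    (hk₁ : ∀ z ∈ Ω, fderiv ℝ ρ z 1 = k z * z.re)
    (hk₂ : ∀ z ∈ Ω, fderiv ℝ ρ z Complex.I = k z * z.im) :
    IntegrableOn (fluxDensity σ k u G) Ω ∧ ∫ z in Ω, fluxDensity σ k u G z = 0 := by
  have hv := hρ.memVWith hΩ hpos hG
  have hi := integrableOn_form hΩ hw hpos hG hv hσ hS
  have h0 := hu.2 G hG.1 _ _ (memV_iff.2 ⟨_, hv⟩) hv.1
  -- Expanding the gradient of `ρ u`, the part with the factor `ρ` is `ρ σ |∇u|²`, which is real;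
  -- only the part with `∇ρ = k x` survives.
  have heq : ∀ z ∈ Ω, RCLike.im ((σ z : ℂ) * ((G z).1 * starRingEnd ℂ (mulGrad ρ u G z).1 +
      (G z).2 * starRingEnd ℂ (mulGrad ρ u G z).2)) = fluxDensity σ k u G z := by
    intro z hz
    simp [fluxDensity, mulGrad, hk₁ z hz, hk₂ z hz]
    left
    ring
  have hm := hΩ.measurableSet
  constructor
  · exact IntegrableOn.congr_fun hi.im heq hm
  · rw [← setIntegral_congr_fun hm heq, integral_im hi]
    rw [form] at h0
    rw [h0, map_zero]

/-- The sum of the two singular functions. -/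
def wave (μ c : ℝ) (A B : ℂ) (z : ℂ) : ℂ := A * singular (-μ) μ c z + B * singular μ μ c z

/-- The radial derivative `r ∂ᵣ` of `wave`. -/
def waveDeriv (μ c : ℝ) (A B : ℂ) (z : ℂ) : ℂ :=
  Complex.I * μ * (B * singular μ μ c z - A * singular (-μ) μ c z)

/-- On `U` the weak gradients of `u` and `v` differ by the classical gradient of the waves; pairing
with the position vector turns that gradient into `r ∂ᵣ`. -/
theorem ae_radial_derivative {μ c : ℝ} {Ω U : Set ℂ} (hU : IsOpen U) (hUΩ : U ⊆ Ω)
    (hsing : ∀ s : ℝ, ContDiffOn ℝ ∞ (singular s μ c) U ∧ ∀ z ∈ U,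
      fderiv ℝ (singular s μ c) z z = Complex.I * s * singular s μ c z)
    {u v : ℂ → ℂ} {G H : ℂ → ℂ × ℂ} (hG : IsWeakGrad Ω u G) (hH : IsWeakGrad Ω v H) {A B : ℂ}
    (h : ∀ᵐ z, z ∈ U → u z = wave μ c A B z + v z) :
    ∀ᵐ z, z ∈ U → z.re * (G z).1 + z.im * (G z).2 =
      waveDeriv μ c A B z + (z.re * (H z).1 + z.im * (H z).2) := by
  have hs : ContDiffOn ℝ ∞ (wave μ c A B) U :=
    (contDiffOn_const.mul (hsing (-μ)).1).add (contDiffOn_const.mul (hsing μ).1)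
  rw [isWeakGrad_iff] at hG hH
  filter_upwards [hG.1.ae_eq_add hU hUΩ hH.1 hs h, hG.2.ae_eq_add hU hUΩ hH.2 hs h]
    with z h1 h2 hz
  have hd (s : ℝ) : DifferentiableAt ℝ (singular s μ c) z :=
    ((hsing s).1.contDiffAt (hU.mem_nhds hz)).differentiableAt (by simp)
  have e1 : fderiv ℝ (wave μ c A B) z z = waveDeriv μ c A B z := by
    have : HasFDerivAt (wave μ c A B) _ z :=
      ((hd (-μ)).hasFDerivAt.const_mul A).add ((hd μ).hasFDerivAt.const_mul B)
    rw [this.fderiv]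
    simp only [add_apply, smul_apply, smul_eq_mul,
      (hsing (-μ)).2 z hz, (hsing μ).2 z hz, waveDeriv]
    push_cast
    ring
  have e2 : fderiv ℝ (wave μ c A B) z z =
      z.re * fderiv ℝ (wave μ c A B) z 1 + z.im * fderiv ℝ (wave μ c A B) z Complex.I := by
    have h3 : z = z.re • (1 : ℂ) + z.im • Complex.I := by simp
    calc fderiv ℝ (wave μ c A B) z z
        = fderiv ℝ (wave μ c A B) z (z.re • (1 : ℂ) + z.im • Complex.I) := by rw [← h3]
      _ = _ := by
        rw [map_add, map_smul, map_smul, Complex.real_smul, Complex.real_smul]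
  rw [h1 hz, h2 hz, ← e1, e2]
  ring

/-- Here `s` and `D` stand for the waves and their `r ∂ᵣ`, `v` and `E` for the remainder and its `r
∂ᵣ`, and `q` for the square root of its energy density. The difference is linear plus quadratic in
`q`. The linear part is split as `q/t ≤ δ/t² + q²/δ`: the term `δ/t²` has an integral of order `δ`
over a disc of radius `2t`, uniformly in `t`. -/
theorem flux_remainder_le {σ k S M L t δ q : ℝ} {s D v E : ℂ} (hσ : |σ| ≤ S) (ht : 0 < t)
    (hk : |k| ≤ M / t ^ 2) (hs : ‖s‖ ≤ L) (hD : ‖D‖ ≤ L) (hq : 0 ≤ q) (hv : ‖v‖ ≤ t * q)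
    (hE : ‖E‖ ≤ 4 * t * q) (hδ : 0 < δ) :
    |σ * (k * (starRingEnd ℂ s * D).im) - σ * (k * (starRingEnd ℂ (s + v) * (D + E)).im)| ≤
      S * M * (5 * L + 4) * (δ / t ^ 2 + (1 + 1 / δ) * q ^ 2) := by
  have hL : 0 ≤ L := (norm_nonneg _).trans hs
  have hS : 0 ≤ S := (abs_nonneg _).trans hσ
  have hM : 0 ≤ M / t ^ 2 := (abs_nonneg _).trans hk
  have e : σ * (k * (starRingEnd ℂ s * D).im) - σ * (k * (starRingEnd ℂ (s + v) * (D + E)).im) =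
      -(σ * (k * (starRingEnd ℂ s * E + starRingEnd ℂ v * D + starRingEnd ℂ v * E).im)) := by
    simp
    ring
  have h1 : |(starRingEnd ℂ s * E + starRingEnd ℂ v * D + starRingEnd ℂ v * E).im| ≤
      L * (4 * t * q) + t * q * L + t * q * (4 * t * q) := by
    refine (Complex.abs_im_le_norm _).trans ((norm_add₃_le).trans ?_)
    simp only [norm_mul, RCLike.norm_conj]
    gcongr
  have h2 : q / t ≤ δ / t ^ 2 + (1 / δ) * q ^ 2 := by
    have h3 : 0 ≤ (1 / δ) * (δ / t - q) ^ 2 := by positivity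
    have h4 : (1 / δ) * (δ / t - q) ^ 2 = δ / t ^ 2 + (1 / δ) * q ^ 2 - 2 * (q / t) := by
      field_simp
      ring
    have h5 : 0 ≤ q / t := by positivity
    linarith
  have hM' : 0 ≤ M := by
    rw [← div_mul_cancel₀ M (pow_pos ht 2).ne']
    positivity
  rw [e, abs_neg, abs_mul, abs_mul]
  calc |σ| * (|k| * |(starRingEnd ℂ s * E + starRingEnd ℂ v * D + starRingEnd ℂ v * E).im|)
      ≤ S * (M / t ^ 2 * (L * (4 * t * q) + t * q * L + t * q * (4 * t * q))) := by gcongr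
    _ = S * M * (5 * L * (q / t) + 4 * q ^ 2) := by field_simp; ring
    _ ≤ S * M * ((5 * L + 4) * (δ / t ^ 2 + (1 + 1 / δ) * q ^ 2)) := by
        refine mul_le_mul_of_nonneg_left ?_ (mul_nonneg hS hM')
        have h6 : 0 ≤ δ / t ^ 2 + (1 / δ) * q ^ 2 := by positivity
        have h7 := mul_le_mul_of_nonneg_left h2 (by positivity : 0 ≤ 5 * L)
        have h8 : 0 ≤ L * q ^ 2 := by positivity
        linarith
    _ = _ := by ring

theorem norm_wave_le {μ c L : ℝ} (hL : ∀ z : ℂ, |phi μ c z.arg| ≤ L) (A B : ℂ) {z : ℂ}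
    (hz : z ≠ 0) : ‖wave μ c A B z‖ ≤ (1 + |μ|) * ((‖A‖ + ‖B‖) * L) ∧
      ‖waveDeriv μ c A B z‖ ≤ (1 + |μ|) * ((‖A‖ + ‖B‖) * L) := by
  obtain ⟨E, hE, h1, h2⟩ := exists_singular_eq hz μ c
  have k1 : ‖singular μ μ c z‖ ≤ L := by rw [h1]; simpa [hE] using hL z
  have k2 : ‖singular (-μ) μ c z‖ ≤ L := by rw [h2]; simpa [hE] using hL z
  have hL0 : 0 ≤ L := (abs_nonneg _).trans (hL z)
  have b1 : ‖A‖ * ‖singular (-μ) μ c z‖ ≤ ‖A‖ * L := by gcongr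
  have b2 : ‖B‖ * ‖singular μ μ c z‖ ≤ ‖B‖ * L := by gcongr
  have p : 0 ≤ (‖A‖ + ‖B‖) * L := by positivity
  constructor
  · have := norm_add_le (A * singular (-μ) μ c z) (B * singular μ μ c z)
    rw [norm_mul, norm_mul] at this
    rw [wave]
    nlinarith [abs_nonneg μ]
  · have := norm_sub_le (B * singular μ μ c z) (A * singular (-μ) μ c z)
    rw [norm_mul, norm_mul] at this
    rw [waveDeriv, norm_mul, norm_mul, Complex.norm_I, one_mul, Complex.norm_real,
      Real.norm_eq_abs]
    have h3 := mul_le_mul_of_nonneg_left (this.trans (add_le_add b2 b1)) (abs_nonneg μ)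
    linarith

theorem flux_wave {z : ℂ} (hz : z ≠ 0) (μ c : ℝ) (A B : ℂ) :
    (starRingEnd ℂ (wave μ c A B z) * waveDeriv μ c A B z).im =
      μ * phi μ c z.arg ^ 2 * (‖B‖ ^ 2 - ‖A‖ ^ 2) := by
  obtain ⟨E, hE, h1, h2⟩ := exists_singular_eq hz μ c
  rw [wave, waveDeriv, h1, h2, im_conj_mul_flux hE]

theorem IsCutoff.cutoffSlope_eq_zero {ψ : ℝ → ℝ} (hψ : IsCutoff ψ) {t : ℝ} (ht : 0 < t) {z : ℂ}
    (hz : ¬(t ≤ ‖z‖ ∧ ‖z‖ ≤ 2 * t)) : cutoffSlope ψ t z = 0 := by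
  rw [cutoffSlope, hψ.deriv_eq_zero, zero_div]
  rintro ⟨h1, h2⟩
  exact hz ⟨(one_le_div ht).1 h1, (div_le_iff₀ ht).1 h2⟩

/-- If the flux of `A r^{-iμ} φ + B r^{iμ} φ + v` vanishes through arcs on which the energy of `v`
becomes small, then `A` and `B` have the same modulus. -/
theorem norm_eq_of_flux_eq_zero {σp σm c : ℝ} (hφ : IsNormalized σp σm c) {ψ : ℝ → ℝ}
    (hψ : IsCutoff ψ) {Ω W : Set ℂ} (hΩ : IsOpen Ω) (hW : IsOpen W) {σ : ℂ → ℝ} {S : ℝ}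
    (hS : ∀ z, |σ z| ≤ S)
    (hm : ∀ z ∈ sector 0 (Real.pi / 4) ∩ W, z ∈ Ω ∧ σ z = σm)
    (hp : ∀ z ∈ sector (Real.pi / 4) Real.pi ∩ W, z ∈ Ω ∧ σ z = σp)
    (h0 : ∀ z ∈ Ω ∩ W, z ∉ sector 0 (Real.pi / 4) → z ∉ sector (Real.pi / 4) Real.pi →
      z.arg ≠ Real.pi / 4 → σ z = 0)
    {u v : ℂ → ℂ} {G H : ℂ → ℂ × ℂ} (hG : IsWeakGrad Ω u G) (hH : IsWeakGrad Ω v H) {A B : ℂ}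
    (hexp : ∀ᵐ z, z ∈ Ω ∩ W → u z = wave (mu σp σm) c A B z + v z)
    {P : ℂ → ℝ} (hP : IntegrableOn P Ω) (hP0 : ∀ z ∈ Ω, 0 ≤ P z)
    (hflux : ∀ κ > 0, ∃ t > 0, (∀ z : ℂ, t ≤ ‖z‖ → ‖z‖ ≤ 2 * t → z ∈ W) ∧
      (∀ z ∈ Ω, t ≤ ‖z‖ → ‖z‖ ≤ 2 * t →
        ‖(H z).1‖ ^ 2 + ‖(H z).2‖ ^ 2 + ‖v z‖ ^ 2 / t ^ 2 ≤ κ * P z) ∧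
      IntegrableOn (fluxDensity σ (cutoffSlope ψ t) u G) Ω ∧
      ∫ z in Ω, fluxDensity σ (cutoffSlope ψ t) u G z = 0) : ‖A‖ = ‖B‖ := by
  obtain ⟨M, hM0, hM⟩ := hψ.exists_deriv_le
  set μ := mu σp σm with hμ
  obtain ⟨Lφ, hLφ0, hLφ⟩ := exists_phi_le μ c
  set L := (1 + |μ|) * ((‖A‖ + ‖B‖) * Lφ) with hL
  have hL0 : 0 ≤ L := by positivity
  have hS0 : 0 ≤ S := (abs_nonneg _).trans (hS 0)
  set K := ‖B‖ ^ 2 - ‖A‖ ^ 2 with hK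
  set C := S * M * (5 * L + 4) with hC
  have hC0 : 0 ≤ C := by positivity
  have hI0 : 0 ≤ ∫ z in Ω, P z := setIntegral_nonneg hΩ.measurableSet hP0
  have rm := ae_radial_derivative (μ := μ) (c := c) (A := A) (B := B)
    ((isOpen_sector le_rfl (by linarith [Real.pi_pos])).inter hW) (fun z hz => (hm z hz).1)
    (fun s => ⟨(singular_lower s μ c).1.mono Set.inter_subset_left,
      fun z hz => (singular_lower s μ c).2 z hz.1⟩) hG hH
    (hexp.mono fun z hz h => hz ⟨(hm z h).1, h.2⟩)
  have rp := ae_radial_derivative (μ := μ) (c := c) (A := A) (B := B)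
    ((isOpen_sector (by positivity) le_rfl).inter hW) (fun z hz => (hp z hz).1)
    (fun s => ⟨(singular_upper s μ c).1.mono Set.inter_subset_left,
      fun z hz => (singular_upper s μ c).2 z hz.1⟩) hG hH
    (hexp.mono fun z hz h => hz ⟨(hp z h).1, h.2⟩)
  -- The first term comes from `δ/t²` on the disc of area `4π t²`, the second from the energy of
  -- `v`. Letting `κ → 0` with `δ` fixed, and then `δ → 0`, gives `K = 0`.
  have main : ∀ δ > 0, ∀ κ > 0,
      |K| ≤ C * (4 * Real.pi * δ) + C * ((1 + 1 / δ) * (κ * ∫ z in Ω, P z)) := by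
    intro δ hδ κ hκ
    obtain ⟨t, ht, hann, hq, hFi, hF⟩ := hflux κ hκ
    by_cases hK0 : K = 0
    · rw [hK0, abs_zero]
      positivity
    have hMint : ∫ z : ℂ, K * (cutoffSlope ψ t z * angularFlux σp σm c z.arg) = -K := by
      rw [integral_const_mul, integral_cutoffSlope_mul_angularFlux hφ hψ ht]
      ring
    -- A non-integrable function has integral `0` by convention, whereas this integral is `-K ≠ 0`;
    -- so integrability is free.
    have hMi : Integrable fun z : ℂ => K * (cutoffSlope ψ t z * angularFlux σp σm c z.arg) := by
      by_contra h
      rw [integral_undef h] at hMint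
      exact hK0 (neg_eq_zero.1 hMint.symm)
    have hFi' := hFi.integrable_indicator hΩ.measurableSet
    have hdiff : ∫ z : ℂ, (K * (cutoffSlope ψ t z * angularFlux σp σm c z.arg) -
        Ω.indicator (fluxDensity σ (cutoffSlope ψ t) u G) z) = -K := by
      rw [integral_sub hMi hFi', hMint, integral_indicator hΩ.measurableSet, hF, sub_zero]
    have b1 : IntegrableOn (fun _ : ℂ => C * (δ / t ^ 2)) (Metric.closedBall (0 : ℂ) (2 * t)) :=
      integrableOn_const (by
        rw [Complex.volume_closedBall]
        exact ENNReal.mul_ne_top (ENNReal.pow_ne_top ENNReal.ofReal_ne_top) ENNReal.coe_ne_top)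
    have b2 : IntegrableOn (fun z => C * ((1 + 1 / δ) * (κ * P z))) Ω :=
      ((hP.const_mul κ).const_mul (1 + 1 / δ)).const_mul C
    -- Off the annulus both terms vanish with the slope of the cut-off. In the annulus the estimate
    -- is needed only in the two sectors; elsewhere, almost everywhere, both terms vanish again.
    have hle : ∀ᵐ z : ℂ, ‖K * (cutoffSlope ψ t z * angularFlux σp σm c z.arg) -
        Ω.indicator (fluxDensity σ (cutoffSlope ψ t) u G) z‖ ≤
        (Metric.closedBall (0 : ℂ) (2 * t)).indicator (fun _ => C * (δ / t ^ 2)) z +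
          Ω.indicator (fun z => C * ((1 + 1 / δ) * (κ * P z))) z := by
      filter_upwards [ae_arg_ne, rm, rp, hexp] with z harg hrm hrp hu
      have bnn : 0 ≤ (Metric.closedBall (0 : ℂ) (2 * t)).indicator (fun _ => C * (δ / t ^ 2)) z +
          Ω.indicator (fun z => C * ((1 + 1 / δ) * (κ * P z))) z := by
        refine add_nonneg (Set.indicator_nonneg (fun _ _ => by positivity) _)
          (Set.indicator_nonneg (fun x hx => ?_) _)
        have := hP0 x hx
        positivity
      by_cases hz : t ≤ ‖z‖ ∧ ‖z‖ ≤ 2 * t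
      swap
      · have hs := hψ.cutoffSlope_eq_zero ht hz
        have : Ω.indicator (fluxDensity σ (cutoffSlope ψ t) u G) z = 0 := by
          rw [Set.indicator_apply_eq_zero]
          intro _
          simp [fluxDensity, hs]
        rwa [this, hs, zero_mul, mul_zero, sub_zero, norm_zero]
      have hzW := hann z hz.1 hz.2
      have hznorm : 0 < ‖z‖ := ht.trans_le hz.1
      have hz0 : z ≠ 0 := norm_pos_iff.1 hznorm
      have sectorCase (hzΩ : z ∈ Ω) (hσ : σ z = sigmaAngle σp σm z.arg)
          (hθ : z.arg ∈ Set.Ioo 0 Real.pi)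
          (hr : z.re * (G z).1 + z.im * (G z).2 =
            waveDeriv μ c A B z + (z.re * (H z).1 + z.im * (H z).2)) :
          ‖K * (cutoffSlope ψ t z * angularFlux σp σm c z.arg) -
            Ω.indicator (fluxDensity σ (cutoffSlope ψ t) u G) z‖ ≤
          (Metric.closedBall (0 : ℂ) (2 * t)).indicator (fun _ => C * (δ / t ^ 2)) z +
            Ω.indicator (fun z => C * ((1 + 1 / δ) * (κ * P z))) z := by
        have hball : z ∈ Metric.closedBall (0 : ℂ) (2 * t) := by
          simpa using hz.2
        rw [Set.indicator_of_mem hzΩ, Set.indicator_of_mem hzΩ, Set.indicator_of_mem hball,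
          fluxDensity, hr, hu ⟨hzΩ, hzW⟩]
        have e1 : K * (cutoffSlope ψ t z * angularFlux σp σm c z.arg) =
            σ z * (cutoffSlope ψ t z *
              (starRingEnd ℂ (wave μ c A B z) * waveDeriv μ c A B z).im) := by
          rw [flux_wave hz0, angularFlux, Set.indicator_of_mem hθ, hσ]
          ring
        set Q := ‖(H z).1‖ ^ 2 + ‖(H z).2‖ ^ 2 + ‖v z‖ ^ 2 / t ^ 2 with hQ
        have hQ0 : 0 ≤ Q := by positivity
        have hsq : √Q ^ 2 = Q := Real.sq_sqrt hQ0
        have n1 : ‖(H z).1‖ ≤ √Q := Real.le_sqrt_of_sq_le (by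
          have : 0 ≤ ‖(H z).2‖ ^ 2 + ‖v z‖ ^ 2 / t ^ 2 := by positivity
          linarith)
        have n2 : ‖(H z).2‖ ≤ √Q := Real.le_sqrt_of_sq_le (by
          have : 0 ≤ ‖(H z).1‖ ^ 2 + ‖v z‖ ^ 2 / t ^ 2 := by positivity
          linarith)
        have n3 : ‖v z‖ ≤ t * √Q := by
          rw [← div_le_iff₀' ht]
          refine Real.le_sqrt_of_sq_le ?_
          rw [div_pow]
          have : 0 ≤ ‖(H z).1‖ ^ 2 + ‖(H z).2‖ ^ 2 := by positivity
          linarith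
        -- The factor `4 t` bounds `|x| + |y|`, each coordinate being at most `2t` on the annulus.
        have n4 : ‖(z.re : ℂ) * (H z).1 + z.im * (H z).2‖ ≤ 4 * t * √Q := by
          have r1 : |z.re| ≤ 2 * t := (Complex.abs_re_le_norm z).trans hz.2
          have r2 : |z.im| ≤ 2 * t := (Complex.abs_im_le_norm z).trans hz.2
          refine (norm_add_le _ _).trans ?_
          rw [norm_mul, norm_mul, Complex.norm_real, Complex.norm_real, Real.norm_eq_abs,
            Real.norm_eq_abs]
          have m1 := mul_le_mul r1 n1 (norm_nonneg _) (by positivity)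
          have m2 := mul_le_mul r2 n2 (norm_nonneg _) (by positivity)
          linarith
        have hk : |cutoffSlope ψ t z| ≤ M / t ^ 2 := by
          rw [cutoffSlope, abs_div, abs_of_pos (mul_pos ht hznorm), pow_two]
          gcongr
          · exact hM _
          · exact hz.1
        have hb := flux_remainder_le (hS z) ht hk (norm_wave_le hLφ A B hz0).1
          (norm_wave_le hLφ A B hz0).2 (Real.sqrt_nonneg Q) n3 n4 hδ
        rw [e1, Real.norm_eq_abs]
        refine hb.trans ?_
        rw [hsq, mul_add]
        have hqz := hq z hzΩ hz.1 hz.2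
        gcongr
      by_cases hzm : z ∈ sector 0 (Real.pi / 4)
      · have h := hm z ⟨hzm, hzW⟩
        exact sectorCase h.1 (by rw [h.2, sigmaAngle, if_pos hzm.2.2])
          ⟨hzm.2.1, by linarith [hzm.2.2, Real.pi_pos]⟩ (hrm ⟨hzm, hzW⟩)
      by_cases hzp : z ∈ sector (Real.pi / 4) Real.pi
      · have h := hp z ⟨hzp, hzW⟩
        exact sectorCase h.1 (by rw [h.2, sigmaAngle, if_neg hzp.2.1.not_gt])
          ⟨by linarith [hzp.2.1, Real.pi_pos], hzp.2.2⟩ (hrp ⟨hzp, hzW⟩)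
      have e1 : angularFlux σp σm c z.arg = 0 := by
        refine Set.indicator_of_notMem (fun hθ => ?_) _
        rcases harg.lt_or_gt with h | h
        · exact hzm ⟨hz0, hθ.1, h⟩
        · exact hzp ⟨hz0, h, hθ.2⟩
      have e2 : Ω.indicator (fluxDensity σ (cutoffSlope ψ t) u G) z = 0 := by
        rw [Set.indicator_apply_eq_zero]
        intro hzΩ
        rw [fluxDensity, h0 z ⟨hzΩ, hzW⟩ hzm hzp harg, zero_mul]
      rwa [e1, e2, mul_zero, mul_zero, sub_zero, norm_zero]
    have b1' := b1.integrable_indicator Metric.isClosed_closedBall.measurableSet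
    have b2' := b2.integrable_indicator hΩ.measurableSet
    have := norm_integral_le_of_norm_le (b1'.add b2') hle
    rw [hdiff, norm_neg, Real.norm_eq_abs] at this
    refine this.trans (le_of_eq ?_)
    simp only [Pi.add_apply]
    rw [integral_add b1' b2', integral_indicator Metric.isClosed_closedBall.measurableSet,
      integral_indicator hΩ.measurableSet, setIntegral_const, integral_const_mul,
      integral_const_mul, integral_const_mul, Measure.real, Complex.volume_closedBall]
    simp only [ENNReal.toReal_mul, ENNReal.toReal_pow, ENNReal.coe_toReal, NNReal.coe_real_pi,
      ENNReal.toReal_ofReal (by positivity : 0 ≤ 2 * t), smul_eq_mul]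
    field_simp
    ring
  have hKδ : ∀ δ > 0, |K| ≤ C * (4 * Real.pi * δ) := by
    intro δ hδ
    have hc : Continuous fun κ : ℝ =>
        C * (4 * Real.pi * δ) + C * ((1 + 1 / δ) * (κ * ∫ z in Ω, P z)) := by fun_prop
    have := (hc.tendsto' 0 (C * (4 * Real.pi * δ)) (by simp)).mono_left
      (nhdsWithin_le_nhds (s := Set.Ioi 0))
    exact ge_of_tendsto this (by filter_upwards [self_mem_nhdsWithin] with κ hκ using main δ hδ κ hκ)
  have hK0 : |K| ≤ 0 := by
    have hc : Continuous fun δ : ℝ => C * (4 * Real.pi * δ) := by fun_prop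
    have := (hc.tendsto' 0 0 (by simp)).mono_left (nhdsWithin_le_nhds (s := Set.Ioi 0))
    exact ge_of_tendsto this (by filter_upwards [self_mem_nhdsWithin] with δ hδ using hKδ δ hδ)
  have hK1 := abs_nonpos_iff.1 hK0
  rw [hK, sub_eq_zero] at hK1
  exact ((sq_eq_sq₀ (norm_nonneg _) (norm_nonneg _)).1 hK1).symm

/-! ### Multipliers and weights -/

/-- Passing from exponent `b` to `b'` costs the factor `w^{2(b'-b)}`, bounded wherever `ρ` or its
gradient is alive. A derivative of `ρ` costs one further power of `w`, absorbed by the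
scale-invariant bound `N` on `|∇ρ|² w²`. -/
theorem isMultiplier_of_forall_or {Ω : Set ℂ} {w : ℂ → ℝ} (hpos : ∀ z ∈ Ω, 0 < w z) {b b' : ℝ}
    {ρ : ℂ → ℝ} (hρ : ContDiff ℝ ∞ ρ) {C N : ℝ} (hC : 0 ≤ C) (hN : 0 ≤ N)
    (h : ∀ z ∈ Ω, (ρ z = 0 ∧ fderiv ℝ ρ z 1 = 0 ∧ fderiv ℝ ρ z Complex.I = 0) ∨
      (w z ^ (2 * (b' - b)) ≤ C ∧ ρ z ^ 2 ≤ 1 ∧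
        ((fderiv ℝ ρ z 1) ^ 2 + (fderiv ℝ ρ z Complex.I) ^ 2) * w z ^ 2 ≤ N)) :
    IsMultiplier Ω w b b' ρ (C * (1 + N)) := by
  have e (z : ℂ) (hz : z ∈ Ω) (s : ℝ) :
      w z ^ (2 * (s + (b' - b))) = w z ^ (2 * (b' - b)) * w z ^ (2 * s) := by
    rw [← Real.rpow_add (hpos z hz)]
    ring_nf
  refine ⟨hρ, fun z hz => ?_, fun z hz => ?_, fun z hz => ?_⟩
  · have p := Real.rpow_pos_of_pos (hpos z hz) (2 * (b - 1))
    rcases h z hz with ⟨h1, -, -⟩ | ⟨h1, h2, -⟩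
    · rw [h1, zero_pow two_ne_zero, mul_zero]; positivity
    · rw [show b' - 1 = (b - 1) + (b' - b) by ring, e z hz]
      calc w z ^ (2 * (b' - b)) * w z ^ (2 * (b - 1)) * ρ z ^ 2
          ≤ C * w z ^ (2 * (b - 1)) * 1 := by gcongr
        _ ≤ C * (1 + N) * w z ^ (2 * (b - 1)) := by
            have : 0 ≤ C * N * w z ^ (2 * (b - 1)) := by positivity
            linarith
  · have p := Real.rpow_pos_of_pos (hpos z hz) (2 * b)
    rcases h z hz with ⟨h1, -, -⟩ | ⟨h1, h2, -⟩
    · rw [h1, zero_pow two_ne_zero, mul_zero]; positivity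
    · rw [show 2 * b' = 2 * (b + (b' - b)) by ring, e z hz]
      calc w z ^ (2 * (b' - b)) * w z ^ (2 * b) * ρ z ^ 2
          ≤ C * w z ^ (2 * b) * 1 := by gcongr
        _ ≤ C * (1 + N) * w z ^ (2 * b) := by
            have : 0 ≤ C * N * w z ^ (2 * b) := by positivity
            linarith
  · have hw := hpos z hz
    have p := Real.rpow_pos_of_pos hw (2 * (b - 1))
    rcases h z hz with ⟨-, h1, h2⟩ | ⟨h1, -, h2⟩
    · rw [h1, h2, zero_pow two_ne_zero, add_zero, mul_zero]; positivity
    · rw [show 2 * b' = 2 * ((b - 1) + (b' - b)) + (2 : ℕ) by push_cast; ring,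
        Real.rpow_add_natCast hw.ne', e z hz]
      calc w z ^ (2 * (b' - b)) * w z ^ (2 * (b - 1)) * w z ^ 2 *
            ((fderiv ℝ ρ z 1) ^ 2 + (fderiv ℝ ρ z Complex.I) ^ 2)
          = w z ^ (2 * (b' - b)) * w z ^ (2 * (b - 1)) *
            (((fderiv ℝ ρ z 1) ^ 2 + (fderiv ℝ ρ z Complex.I) ^ 2) * w z ^ 2) := by ring
        _ ≤ C * w z ^ (2 * (b - 1)) * N := by gcongr
        _ ≤ C * (1 + N) * w z ^ (2 * (b - 1)) := by
            have : 0 ≤ C * w z ^ (2 * (b - 1)) := by positivity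
            linarith

/-- The weighted norm controls the scale-invariant energy with a gain `w^{-2b}`. This gain tends to
zero on the annuli both for `b = -β`, `t → 0` and for `b = β`, `t → ∞`. -/
theorem energy_le_normDensity {w : ℂ → ℝ} {z : ℂ} (hw : 0 < w z) {m t : ℝ} (hm : 1 ≤ m)
    (ht : 0 < t) (hwt : w z ≤ m * t) (b : ℝ) (v : ℂ → ℂ) (H : ℂ → ℂ × ℂ) :
    ‖(H z).1‖ ^ 2 + ‖(H z).2‖ ^ 2 + ‖v z‖ ^ 2 / t ^ 2 ≤
      m ^ 2 * w z ^ (-(2 * b)) * normDensity w b v H z := by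
  have e1 : w z ^ (-(2 * b)) * w z ^ (2 * b) = 1 := by
    rw [← Real.rpow_add hw]; simp
  have e2 : w z ^ (-(2 * b)) * w z ^ (2 * (b - 1)) * w z ^ 2 = 1 := by
    rw [← Real.rpow_add hw, ← Real.rpow_natCast, ← Real.rpow_add hw]
    ring_nf
    simp
  have e3 : w z ^ (-(2 * b)) * w z ^ (2 * (b - 1)) = 1 / w z ^ 2 := by
    rw [eq_div_iff (by positivity), e2]
  have e4 : m ^ 2 * w z ^ (-(2 * b)) * normDensity w b v H z =
      m ^ 2 * (1 / w z ^ 2) * ‖v z‖ ^ 2 + m ^ 2 * (‖(H z).1‖ ^ 2 + ‖(H z).2‖ ^ 2) := by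
    rw [normDensity, ← e3]
    linear_combination (m ^ 2 * (‖(H z).1‖ ^ 2 + ‖(H z).2‖ ^ 2)) * e1
  have h1 : ‖v z‖ ^ 2 / t ^ 2 ≤ m ^ 2 * (1 / w z ^ 2) * ‖v z‖ ^ 2 := by
    rw [div_eq_mul_one_div, mul_comm]
    refine mul_le_mul_of_nonneg_right ?_ (sq_nonneg _)
    rw [mul_one_div, div_le_div_iff₀ (by positivity) (by positivity), one_mul, ← mul_pow]
    gcongr
  have h2 : ‖(H z).1‖ ^ 2 + ‖(H z).2‖ ^ 2 ≤ m ^ 2 * (‖(H z).1‖ ^ 2 + ‖(H z).2‖ ^ 2) :=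
    le_mul_of_one_le_left (by positivity) (one_le_pow₀ hm)
  linarith

theorem sq_cutoffSlope_mul_le {ψ : ℝ → ℝ} (hψ : IsCutoff ψ) {M : ℝ} (hM : ∀ r, |deriv ψ r| ≤ M)
    {t : ℝ} (ht : 0 < t) {z : ℂ} {w m : ℝ} (hw : 0 ≤ w) (hm : ‖z‖ ≤ 2 * t → w ≤ m * t) :
    ((cutoffSlope ψ t z * z.re) ^ 2 + (cutoffSlope ψ t z * z.im) ^ 2) * w ^ 2 ≤ (M * m) ^ 2 := by
  by_cases hz : t ≤ ‖z‖ ∧ ‖z‖ ≤ 2 * t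
  · have hz0 : 0 < ‖z‖ := ht.trans_le hz.1
    have e : ((cutoffSlope ψ t z * z.re) ^ 2 + (cutoffSlope ψ t z * z.im) ^ 2) * w ^ 2 =
        (|deriv ψ (‖z‖ / t)| * (w / t)) ^ 2 := by
      have h : z.re ^ 2 + z.im ^ 2 = ‖z‖ ^ 2 := by
        rw [Complex.sq_norm, Complex.normSq_apply]; ring
      rw [mul_pow, mul_pow, ← mul_add, h, cutoffSlope, mul_pow, sq_abs]
      field_simp
    rw [e]
    have h1 : w / t ≤ m := (div_le_iff₀ ht).2 (hm hz.2)
    have h2 := hM (‖z‖ / t)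
    have h3 : 0 ≤ M := (abs_nonneg _).trans h2
    gcongr
  · rw [hψ.cutoffSlope_eq_zero ht hz]
    simp
    positivity

theorem measurable_coeff (σp σm : ℝ) {P M : Set ℂ} (hP : IsOpen P) (hM : IsOpen M) :
    Measurable (coeff σp σm P M) :=
  Measurable.ite hP.measurableSet measurable_const
    (Measurable.ite hM.measurableSet measurable_const measurable_const)

theorem abs_coeff_le (σp σm : ℝ) (P M : Set ℂ) (z : ℂ) :
    |coeff σp σm P M z| ≤ |σp| + |σm| := by
  unfold coeff
  split_ifs
  · linarith [abs_nonneg σm]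
  · linarith [abs_nonneg σp]
  · rw [abs_zero]; positivity

/-! ### The outer problem -/

/-- The corner is a boundary point of an open set; this makes the weight `r` positive on `Ω`. -/
theorem OuterGeometry.zero_notMem {Ω Ωp Ωm : Set ℂ} {O' : ℂ} (h : OuterGeometry Ω Ωp Ωm O') :
    (0 : ℂ) ∉ Ω := by
  have h1 : (0 : ℂ) ∈ segment ℝ 0 O' ∩ frontier Ω := by
    rw [h.endpoints]
    exact Set.mem_insert _ _
  have h2 := h1.2
  rw [h.isOpen.frontier_eq] at h2
  exact h2.2

/-- The factor vanishes for `r < t`, and for `r ≥ t` the lost weight satisfies `r^{-4β} ≤ t^{-4β}`.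
-/
theorem IsCutoff.isMultiplier_outer {ψ : ℝ → ℝ} (hψ : IsCutoff ψ) {Ω : Set ℂ}
    (h0 : (0 : ℂ) ∉ Ω) {β : ℝ} (hβ : 0 < β) {t : ℝ} (ht : 0 < t) :
    ∃ C, IsMultiplier Ω outerWeight β (-β) (fun z => 1 - radialCutoff ψ t z) C := by
  obtain ⟨M, -, hM⟩ := hψ.exists_deriv_le
  have hne (z : ℂ) (hz : z ∈ Ω) : z ≠ 0 := fun h => h0 (h ▸ hz)
  refine ⟨_, isMultiplier_of_forall_or (N := (M * 2) ^ 2) (C := t ^ (2 * (-β - β)))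
    (fun z hz => norm_pos_iff.2 (hne z hz))
    (contDiff_const.sub (hψ.contDiff_radialCutoff ht)) (by positivity) (by positivity) ?_⟩
  intro z hz
  simp only [fderiv_const_sub, neg_apply, hψ.fderiv_radialCutoff (hne z hz), Complex.one_re,
    Complex.one_im, Complex.I_re, Complex.I_im, mul_one, mul_zero, add_zero, zero_add, neg_sq]
  rcases lt_or_ge ‖z‖ t with h | h
  · left
    have h1 : radialCutoff ψ t z = 1 := hψ.2.2.1 _ ((div_le_one ht).2 h.le)
    rw [h1, hψ.cutoffSlope_eq_zero ht fun h' => h'.1.not_gt h]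
    simp
  · right
    refine ⟨Real.rpow_le_rpow_of_nonpos ht h (by linarith), ?_,
      sq_cutoffSlope_mul_le hψ hM ht (norm_nonneg z) fun h => h⟩
    have h1 := hψ.2.1 (‖z‖ / t)
    have h2 : radialCutoff ψ t z ∈ Set.Icc (0 : ℝ) 1 := h1
    exact pow_le_one₀ (by linarith [h2.2]) (by linarith [h2.1])

theorem norm_outer_coefficient {σp σm c : ℝ} (hφ : IsNormalized σp σm c) {ψ : ℝ → ℝ}
    (hψ : IsCutoff ψ) {β : ℝ} (hβ : 0 < β) {Ω Ωp Ωm : Set ℂ} {O' : ℂ}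
    (hgeo : OuterGeometry Ω Ωp Ωm O') {ζ : ℂ → ℂ} {cζ : ℂ}
    (hker : MemKer Ω (coeff σp σm Ωp Ωm) outerWeight β ζ)
    (hexp : OuterExpansion Ω ψ β (mu σp σm) c ζ cζ) : ‖cζ‖ = 1 := by
  obtain ⟨v, hv, hexp⟩ := hexp
  obtain ⟨H, hH⟩ := memV_iff.1 hv
  obtain ⟨G, hG⟩ := memV_iff.1 hker.1
  have h0 := hgeo.zero_notMem
  have hne (z : ℂ) (hz : z ∈ Ω) : z ≠ 0 := fun h => h0 (h ▸ hz)
  have hpos (z : ℂ) (hz : z ∈ Ω) : 0 < outerWeight z := norm_pos_iff.2 (hne z hz)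
  have hw : Continuous outerWeight := continuous_norm
  have hball {z : ℂ} (hz : z ∈ Metric.ball (0 : ℂ) 1) : z ∈ Metric.ball (0 : ℂ) 2 :=
    Metric.ball_subset_ball (by norm_num) hz
  have hsub : Ωp ∪ Ωm ⊆ Ω := hgeo.union ▸ Set.sdiff_subset
  have hm (z : ℂ) (hz : z ∈ sector 0 (Real.pi / 4) ∩ Metric.ball 0 1) : z ∈ Ωm :=
    (hgeo.corner_m ▸ (⟨hz.1, hball hz.2⟩ : z ∈ sector 0 (Real.pi / 4) ∩ Metric.ball 0 2) :
      z ∈ Ωm ∩ Metric.ball 0 2).1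
  have hp (z : ℂ) (hz : z ∈ sector (Real.pi / 4) Real.pi ∩ Metric.ball 0 1) : z ∈ Ωp :=
    (hgeo.corner_p ▸ (⟨hz.1, hball hz.2⟩ : z ∈ sector (Real.pi / 4) Real.pi ∩ Metric.ball 0 2) :
      z ∈ Ωp ∩ Metric.ball 0 2).1
  suffices h : ‖(1 : ℂ)‖ = ‖cζ‖ by rw [← h, norm_one]
  -- The expansion holds without cut-off in the unit disc, where `ψ = 1`; there `A = 1` and `B =
  -- cζ`.
  refine norm_eq_of_flux_eq_zero hφ hψ hgeo.isOpen (W := Metric.ball 0 1) Metric.isOpen_ball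
    (abs_coeff_le σp σm Ωp Ωm) (fun z hz => ⟨hsub (.inr (hm z hz)), ?_⟩)
    (fun z hz => ⟨hsub (.inl (hp z hz)), ?_⟩) (fun z hz h1 h2 _ => ?_) hG.1 hH.1 ?_
    (hH.integrableOn hgeo.isOpen hw hpos) (fun z hz => normDensity_nonneg (hpos z hz) _ _ _) ?_
  · have h1 := hm z hz
    rw [coeff, if_neg (fun h => Set.disjoint_left.1 hgeo.disjoint h h1), if_pos h1]
  · rw [coeff, if_pos (hp z hz)]
  · rw [coeff, if_neg, if_neg]
    · exact fun h => h1 (hgeo.corner_m ▸ (⟨h, hball hz.2⟩ : z ∈ Ωm ∩ Metric.ball 0 2) :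
        z ∈ sector 0 (Real.pi / 4) ∩ Metric.ball 0 2).1
    · exact fun h => h2 (hgeo.corner_p ▸ (⟨h, hball hz.2⟩ : z ∈ Ωp ∩ Metric.ball 0 2) :
        z ∈ sector (Real.pi / 4) Real.pi ∩ Metric.ball 0 2).1
  · rw [ae_restrict_iff' hgeo.isOpen.measurableSet] at hexp
    filter_upwards [hexp] with z hz hz'
    have : ψ ‖z‖ = 1 := hψ.2.2.1 _ (by simpa using (mem_ball_zero_iff.1 hz'.2).le)
    rw [hz hz'.1, this, wave]
    push_cast
    ring
  · intro κ hκ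
    -- With `b = -β` the gain is `r^{2β} ≤ (2t)^{2β}`. Taking `t < 1/2` keeps the annulus inside the
    -- unit disc.
    have hlim : Tendsto (fun t : ℝ => 2 ^ 2 * (2 * t) ^ (2 * β)) (𝓝[>] 0) (𝓝 0) := by
      have hc : Continuous fun t : ℝ => 2 ^ 2 * (2 * t) ^ (2 * β) :=
        continuous_const.mul ((continuous_const.mul continuous_id).rpow_const
          fun _ => .inr (by positivity))
      refine (hc.tendsto' 0 0 ?_).mono_left nhdsWithin_le_nhds
      rw [mul_zero, Real.zero_rpow (by positivity), mul_zero]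
    obtain ⟨t, hκt, ht, ht2⟩ := ((hlim.eventually (gt_mem_nhds hκ)).and
      (Ioo_mem_nhdsGT (by norm_num : (0 : ℝ) < 1 / 2))).exists
    refine ⟨t, ht, fun z _ hz => ?_, fun z hzΩ hz1 hz2 => ?_, ?_⟩
    · rw [mem_ball_zero_iff]
      linarith
    · refine (energy_le_normDensity (hpos z hzΩ) one_le_two ht hz2 (-β) v H).trans ?_
      refine mul_le_mul_of_nonneg_right (le_trans ?_ hκt.le) (normDensity_nonneg (hpos z hzΩ) _ _ _)
      rw [mul_neg, neg_neg]
      refine mul_le_mul_of_nonneg_left ?_ (by norm_num)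
      exact Real.rpow_le_rpow (norm_nonneg z) hz2 (by positivity)
    · obtain ⟨C, hC⟩ := hψ.isMultiplier_outer h0 hβ ht
      have := hker.integral_fluxDensity hgeo.isOpen hw hpos
        (measurable_coeff σp σm hgeo.isOpen_p hgeo.isOpen_m) (abs_coeff_le σp σm Ωp Ωm) hG hC
        (k := fun z => -cutoffSlope ψ t z)
        (fun z hz => by simp [fderiv_const_sub, hψ.fderiv_radialCutoff (hne z hz)])
        (fun z hz => by simp [fderiv_const_sub, hψ.fderiv_radialCutoff (hne z hz)])
      -- The gradient of `1 - ψ(r/t)` is opposite to that of `ψ(r/t)`, and the flux is linear in the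
      -- slope.
      have e : fluxDensity (coeff σp σm Ωp Ωm) (fun z => -cutoffSlope ψ t z) ζ G =
          -fluxDensity (coeff σp σm Ωp Ωm) (cutoffSlope ψ t) ζ G := by
        ext z
        simp [fluxDensity]
      rw [e] at this
      refine ⟨by simpa using this.1.neg, ?_⟩
      simpa [integral_neg] using this.2

/-! ### The inner problem -/

theorem isOpen_Xi : IsOpen Xi := isOpen_lt continuous_const Complex.continuous_im

theorem ne_zero_of_mem_Xi {z : ℂ} (hz : z ∈ Xi) : z ≠ 0 :=
  Complex.slitPlane_ne_zero (Xi_subset_slitPlane hz)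

/-- The factor vanishes for `r > 2t`; inside, `1 + r ≤ 3t` because `t ≥ 1`, so the lost weight
`(1+r)^{4β}` is bounded. The target is written `-(-β)` to match the test space of a kernel of
exponent `-β`. -/
theorem IsCutoff.isMultiplier_inner {ψ : ℝ → ℝ} (hψ : IsCutoff ψ) {β : ℝ} (hβ : 0 < β) {t : ℝ}
    (ht : 1 ≤ t) : ∃ C, IsMultiplier Xi innerWeight (-β) (-(-β)) (radialCutoff ψ t) C := by
  obtain ⟨M, -, hM⟩ := hψ.exists_deriv_le
  have ht0 : 0 < t := by linarith
  refine ⟨_, isMultiplier_of_forall_or (N := (M * 3) ^ 2)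
    (C := (3 * t) ^ (2 * (- (-β) - -β))) (fun z _ => by unfold innerWeight; positivity)
    (hψ.contDiff_radialCutoff ht0) (by positivity) (by positivity) ?_⟩
  intro z hz
  simp only [hψ.fderiv_radialCutoff (ne_zero_of_mem_Xi hz), Complex.one_re,
    Complex.one_im, Complex.I_re, Complex.I_im, mul_one, mul_zero, add_zero, zero_add]
  rcases lt_or_ge (2 * t) ‖z‖ with h | h
  · left
    have h1 : radialCutoff ψ t z = 0 := hψ.2.2.2 _ ((le_div_iff₀ ht0).2 h.le)
    rw [h1, hψ.cutoffSlope_eq_zero ht0 fun h' => h'.2.not_gt h]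
    simp
  · right
    have hw : innerWeight z ≤ 3 * t := by unfold innerWeight; linarith
    have hw0 : 0 ≤ innerWeight z := by unfold innerWeight; positivity
    refine ⟨Real.rpow_le_rpow hw0 hw (by linarith), ?_,
      sq_cutoffSlope_mul_le hψ hM ht0 hw0 fun _ => hw⟩
    have h2 : radialCutoff ψ t z ∈ Set.Icc (0 : ℝ) 1 := hψ.2.1 (‖z‖ / t)
    exact pow_le_one₀ h2.1 h2.2

theorem norm_inner_coefficient {σp σm c : ℝ} (hφ : IsNormalized σp σm c) {ψ : ℝ → ℝ}
    (hψ : IsCutoff ψ) {β : ℝ} (hβ : 0 < β) {Ξp Ξm : Set ℂ} {γ : ℝ → ℂ}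
    (hgeo : InnerGeometry Ξp Ξm γ) {Z : ℂ → ℂ} {CZ : ℂ}
    (hker : MemKer Xi (coeff σp σm Ξp Ξm) innerWeight (-β) Z)
    (hexp : InnerExpansion ψ β (mu σp σm) c Z CZ) : ‖CZ‖ = 1 := by
  obtain ⟨v, hv, hexp⟩ := hexp
  obtain ⟨H, hH⟩ := memV_iff.1 hv
  obtain ⟨G, hG⟩ := memV_iff.1 hker.1
  obtain ⟨R, hRm, hRp⟩ := hgeo.far
  have hpos (z : ℂ) (_ : z ∈ Xi) : 0 < innerWeight z := by unfold innerWeight; positivity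
  have hw : Continuous innerWeight := continuous_const.add continuous_norm
  have hsub : Ξp ∪ Ξm ⊆ Xi := hgeo.union ▸ Set.sdiff_subset
  suffices h : ‖CZ‖ = ‖(1 : ℂ)‖ by rw [h, norm_one]
  have hm (z : ℂ) (hz : z ∈ sector 0 (Real.pi / 4) ∩ {z : ℂ | max R 2 < ‖z‖}) : z ∈ Ξm :=
    hRm z hz.1 ((le_max_left R 2).trans_lt hz.2)
  have hp (z : ℂ) (hz : z ∈ sector (Real.pi / 4) Real.pi ∩ {z : ℂ | max R 2 < ‖z‖}) : z ∈ Ξp :=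
    hRp z hz.1 ((le_max_left R 2).trans_lt hz.2)
  -- Beyond radius `max R 2` one has `ψ = 0` and the coefficient is constant in each of the two
  -- sectors; there `A = CZ` and `B = 1`.
  refine norm_eq_of_flux_eq_zero hφ hψ isOpen_Xi (W := {z : ℂ | max R 2 < ‖z‖})
    (isOpen_lt continuous_const continuous_norm)
    (abs_coeff_le σp σm Ξp Ξm) (fun z hz => ⟨hsub (.inr (hm z hz)), ?_⟩)
    (fun z hz => ⟨hsub (.inl (hp z hz)), ?_⟩) (fun z hz h1 h2 h3 => ?_) hG.1 hH.1 ?_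
    (hH.integrableOn isOpen_Xi hw hpos) (fun z hz => normDensity_nonneg (hpos z hz) _ _ _) ?_
  · have h1 := hm z hz
    rw [coeff, if_neg (fun h => Set.disjoint_left.1 hgeo.disjoint h h1), if_pos h1]
  · rw [coeff, if_pos (hp z hz)]
  -- A point of the open half plane has argument strictly between `0` and `π`, so off the diagonal
  -- ray it lies in one of the two sectors.
  · exfalso
    have hz0 := ne_zero_of_mem_Xi hz.1
    have him : 0 < z.im := hz.1
    rcases h3.lt_or_gt with h | h
    · refine h1 ⟨hz0, lt_of_le_of_ne (Complex.arg_nonneg_iff.2 him.le) fun h' => ?_, h⟩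
      exact him.ne' (Complex.arg_eq_zero_iff.1 h'.symm).2
    · refine h2 ⟨hz0, h, lt_of_le_of_ne (Complex.arg_le_pi z) fun h' => ?_⟩
      exact him.ne' (Complex.arg_eq_pi_iff.1 h').2
  · rw [ae_restrict_iff' isOpen_Xi.measurableSet] at hexp
    filter_upwards [hexp] with z hz hz'
    have : ψ ‖z‖ = 0 := hψ.2.2.2 _ ((le_max_right R 2).trans_lt hz'.2).le
    rw [hz hz'.1, this, wave]
    push_cast
    ring
  · intro κ hκ
    -- With `b = β` the gain is `(1+r)^{-2β} ≤ t^{-2β}` on the annulus, and `3` comes from `1 + r ≤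
    -- 3t`.
    have hlim : Tendsto (fun t : ℝ => 3 ^ 2 * t ^ (-(2 * β))) atTop (𝓝 0) := by
      simpa using (tendsto_rpow_neg_atTop (by positivity : 0 < 2 * β)).const_mul (3 ^ 2)
    obtain ⟨t, hκt, htR⟩ := ((hlim.eventually (gt_mem_nhds hκ)).and
      (eventually_gt_atTop (max R 2))).exists
    have ht2 : 2 < t := (le_max_right R 2).trans_lt htR
    have ht : 0 < t := by linarith
    refine ⟨t, ht, fun z hz _ => htR.trans_le hz, fun z hzΩ hz1 hz2 => ?_, ?_⟩
    · have hwt : innerWeight z ≤ 3 * t := by unfold innerWeight; linarith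
      refine (energy_le_normDensity (hpos z hzΩ) (by norm_num) ht hwt β v H).trans ?_
      refine mul_le_mul_of_nonneg_right (le_trans ?_ hκt.le) (normDensity_nonneg (hpos z hzΩ) _ _ _)
      refine mul_le_mul_of_nonneg_left ?_ (by norm_num)
      refine Real.rpow_le_rpow_of_nonpos ht ?_ (by linarith)
      unfold innerWeight
      linarith
    · obtain ⟨C, hC⟩ := hψ.isMultiplier_inner hβ (by linarith : 1 ≤ t)
      exact hker.integral_fluxDensity isOpen_Xi hw hpos
        (measurable_coeff σp σm hgeo.isOpen_p hgeo.isOpen_m) (abs_coeff_le σp σm Ξp Ξm) hG hC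
        (fun z hz => by simp [hψ.fderiv_radialCutoff (ne_zero_of_mem_Xi hz)])
        (fun z hz => by simp [hψ.fderiv_radialCutoff (ne_zero_of_mem_Xi hz)])

end SignChanging

end

theorem lemma4p1 (σp σm : ℝ) (hσp : 0 < σp) (hσm : σm < 0)
    (hκ : σm / σp ∈ Set.Ioo (-1 : ℝ) (-1 / 3))
    (cφ : ℝ) (hφ : SignChanging.IsNormalized σp σm cφ)
    (ψ : ℝ → ℝ) (hψ : SignChanging.IsCutoff ψ)
    (β : ℝ) (hβ : β ∈ Set.Ioo (0 : ℝ) 2) :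
    (∀ (Ω Ωp Ωm : Set ℂ) (O' : ℂ), SignChanging.OuterGeometry Ω Ωp Ωm O' →
      ∀ (ζ : ℂ → ℂ) (cζ : ℂ),
        SignChanging.MemKer Ω (SignChanging.coeff σp σm Ωp Ωm) SignChanging.outerWeight β ζ →
        SignChanging.OuterExpansion Ω ψ β (SignChanging.mu σp σm) cφ ζ cζ →
        ‖cζ‖ = 1) ∧
    (∀ (Ξp Ξm : Set ℂ) (γ : ℝ → ℂ), SignChanging.InnerGeometry Ξp Ξm γ →
      ∀ (Z : ℂ → ℂ) (CZ : ℂ),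
        SignChanging.MemKer SignChanging.Xi (SignChanging.coeff σp σm Ξp Ξm)
          SignChanging.innerWeight (-β) Z →
        SignChanging.InnerExpansion ψ β (SignChanging.mu σp σm) cφ Z CZ →
        ‖CZ‖ = 1) := by
  exact ⟨fun Ω Ωp Ωm O' hgeo ζ cζ hker hexp =>
      SignChanging.norm_outer_coefficient hφ hψ hβ.1 hgeo hker hexp,
    fun Ξp Ξm γ hgeo Z CZ hker hexp =>
      SignChanging.norm_inner_coefficient hφ hψ hβ.1 hgeo hker hexp⟩
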